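/- **Setting.** Let $M$ be a smooth manifold (possibly with boundary or corners), $V=\bigoplus_{i\in\mathbb Z}V^i$ a $\mathbb Z$-graded real vector space, and $\underline V$ a local system of graded vector spaces on $M$ with fibres $V_x\cong V$ and flat connection $\nabla$. Put $\mathfrak g_x=\prod_{n\ge 0}\mathrm{Hom}(V_x^{\otimes n},V_x[1-n])$. For homogeneous inputs $a_1,a_2,\dots$ write $\maltese_j=\sum_{i\le j}(|a_i|-1)$. For $f\in\mathrm{Hom}(V_x^{\otimes k},V_x)$ and $g\in\mathrm{Hom}(V_x^{\otimes r},V_x)$ of reduced degrees $\|f\|,\|g\|$ (an element of $\mathrm{Hom}(V_x^{\otimes n},V_x[1-n+e])$ has reduced degree $e$), put $(f\circ g)(a_1,\dots,a_{k+r-1})=\sum_{j=0}^{k-1}(-1)^{\|g\|\maltese_j}f(a_1,\dots,a_j,g(a_{j+1},\dots,a_{j+r}),a_{j+r+1},\dots,a_{k+r-1})$, and $[f,g]=f\circ g-(-1)^{\|f\|\|g\|}g\circ f$. For $\mathfrak g$-valued forms, $[\omega\otimes f,\theta\otimes g]=(-1)^{|\theta|\,\|f\|}\,\omega\wedge\theta\otimes[f,g]$.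 If $V$ is infinite-dimensional, a map into $V$ is called smooth when its composition with every linear functional is smooth (such a map locally has values in a finite-dimensional subspace), vector-valued integrals are defined by pairing with linear functionals, and a $\mathrm{Hom}(V^{\otimes n},V)$-valued map is called smooth when its value on every $n$-tuple of vectors is. Let $\alpha=\sum_{m,n}\alpha^{m,n}$, with $\alpha^{m,n}\in\Omega^m(M;\mathrm{Hom}(\underline V^{\otimes n},\underline V[2-m-n]))$ smooth, satisfy the Maurer–Cartan equation $d_\nabla\alpha+\tfrac12[\alpha,\alpha]=0$ and $\alpha^{0,0}=\alpha^{1,0}=\alpha^{2,0}=0$. For $x\in M$ let $\mathcal A_x$ denote $V_x$ with the operations $\mu_x^n=\alpha_x^{0,n}$. Let $\gamma:[0,1]\to M$ be a $C^1$ path, and choose a graded trivialization of $\gamma^*\underline V$ compatible with the flat connection. In it write $\gamma^*\alpha^{1,r}=A^r_t\,dt$ with $A^r_t:V^{\otimes r}\to V$. For $t_1,\dots,t_i\in[0,1]$, the $(i,n)$-trees at $(t_1,\dots,t_i)$ are the sum of all planar rooted trees with $n$ leaves and $i$ levels, each level carrying exactly one vertex and otherwise identity strands, where the vertex of the $l$-th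 level counted from the leaves, if it has $r\ge1$ incoming edges, is decorated by $A^r_{t_l}$. Equivalently, it is the sum of all maps $V^{\otimes n}\to V$ of the form $$A^{r_i}_{t_i}\circ(1^{\otimes j_{i-1}}\otimes A^{r_{i-1}}_{t_{i-1}}\otimes1\otimes\cdots\otimes1)\circ\cdots\circ(1^{\otimes j_1}\otimes A^{r_1}_{t_1}\otimes1\otimes\cdots\otimes1).$$ The $(0,1)$-tree is the identity, and there is no $(0,n)$-tree for $n\neq1$. For an integer $d\ge0$ and $p,q\in[0,1]$ define, for $n\ge1$, $$\mathcal F^n_{p\to q}=\sum_{i=0}^{n-1+d}(-1)^i\int_{p\le t_1\le\cdots\le t_i\le q}(i,n)\text{-trees}\;dt_1\cdots dt_i ,$$ regarded through the trivialization as a map $V_{\gamma(p)}^{\otimes n}\to V_{\gamma(q)}$. If $p>q$, the inequalities are reversed and the integral is oriented, i.e. it is the iterated integral $\int_p^q\!\int_{t_1}^q\!\cdots\int_{t_{i-1}}^q dt_i\cdots dt_1$. **Theorem.** Suppose $\alpha^{1,1}=0$. Then for all $p,q\in[0,1]$ and every $d\ge 0$ the maps $\mathcal F^n_{p\to q}$,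 $n\ge 1$, are well-defined multilinear maps and form an $A_\infty$ morphism $\mathcal A_{\gamma(p)}\to\mathcal A_{\gamma(q)}$. That is, $\mathcal A_{\gamma(p)}$ and $\mathcal A_{\gamma(q)}$ are $A_\infty$ algebras: at $x=\gamma(p)$ and $x=\gamma(q)$, $\mu_x^n$ has degree $2-n$ and $\sum_{k+r=n+1}\sum_{j=0}^{k-1}(-1)^{\maltese_j}\mu_x^k(a_1,\dots,a_j,\mu_x^r(a_{j+1},\dots,a_{j+r}),a_{j+r+1},\dots,a_n)=0$ for all $n\ge0$. Moreover $\mathcal F^n=\mathcal F^n_{p\to q}$ has degree $1-n$, and for all $n\ge1$ and all homogeneous $a_1,\dots,a_n\in V_{\gamma(p)}$ $$\sum_{\substack{1\le r\le n\\ s_1+\cdots+s_r=n,\ s_i\ge1}}\mu^r_{\gamma(q)}\big(\mathcal F^{s_1}(a_1,\dots,a_{s_1}),\dots,\mathcal F^{s_r}(a_{n-s_r+1},\dots,a_n)\big)=\sum_{m=1}^n\sum_{j=0}^{n-m}(-1)^{\maltese_j}\mathcal F^{n-m+1}\big(a_1,\dots,a_j,\mu^m_{\gamma(p)}(a_{j+1},\dots,a_{j+m}),a_{j+m+1},\dots,a_n\big).$$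 -/

import Mathlib

open scoped Manifold ContDiff Topology

noncomputable section

namespace AInfFamily

/-! ### Operations on multilinear maps

Finite tuples of inputs `a₁, …, aₙ` are given as the first `n` terms of a sequence `a : ℕ → V`
(zero-based), with degrees `deg : ℕ → ℤ`. A `ℤ`-graded vector space is a real vector space `V` with
subspaces `𝒱 i`, `i : ℤ`, of which it is the internal direct sum. -/

section Multilinear

variable {V : Type*} [AddCommGroup V] [Module ℝ V] {W : Type*} [AddCommGroup W] [Module ℝ W]

/-- `f : V^{⊗ n} → W[k]`, that is, `f` raises the total degree by `k`. -/
def IsHomogeneous (𝒱 : ℤ → Submodule ℝ V) (𝒲 : ℤ → Submodule ℝ W) {n : ℕ}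
    (f : MultilinearMap ℝ (fun _ : Fin n => V) W) (k : ℤ) : Prop :=
  ∀ (deg : Fin n → ℤ) (a : Fin n → V), (∀ i, a i ∈ 𝒱 (deg i)) → f a ∈ 𝒲 ((∑ i, deg i) + k)

/-- The reduced degree `∑_{i ≤ j} (|a_i| - 1)` of the first `j` inputs. -/
def maltese (deg : ℕ → ℤ) (j : ℕ) : ℤ := ∑ i ∈ Finset.range j, (deg i - 1)

/-- `(a₁, …, a_j, x, a_{j+r+1}, a_{j+r+2}, …)`: the `r` entries after the first `j` are replaced
by the single entry `x`. -/
def insertAt (a : ℕ → V) (j r : ℕ) (x : V) : ℕ → V :=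
  fun i => if i < j then a i else if i = j then x else a (i + r - 1)

/-- The Gerstenhaber composition
`∑_j (-1)^{e ✠_j} f(a₁, …, a_j, g(a_{j+1}, …, a_{j+r}), a_{j+r+1}, …, a_{k+r-1})`
where `e` is the reduced degree of `g`. -/
def gComp {k r : ℕ} (f : MultilinearMap ℝ (fun _ : Fin k => V) W)
    (g : MultilinearMap ℝ (fun _ : Fin r => V) V) (e : ℤ) (deg : ℕ → ℤ) (a : ℕ → V) : W :=
  ∑ j ∈ Finset.range k, (-1 : ℝ) ^ (e * maltese deg j) •
    f (fun i : Fin k => insertAt a j r (g fun i : Fin r => a (j + i)) i)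

/-- The Gerstenhaber bracket `f ∘ g - (-1)^{e_f e_g} g ∘ f`, where `e_f`, `e_g` are the reduced
degrees of `f` and `g`. -/
def gBracket {k r : ℕ} (f : MultilinearMap ℝ (fun _ : Fin k => V) V)
    (g : MultilinearMap ℝ (fun _ : Fin r => V) V) (ef eg : ℤ) (deg : ℕ → ℤ) (a : ℕ → V) : V :=
  gComp f g eg deg a - (-1 : ℝ) ^ (ef * eg) • gComp g f ef deg a

/-- The maps `μ n : V^{⊗ n} → V[2 - n]`, `n ≥ 0`, form an A∞ algebra. -/
structure IsAInfAlgebra (𝒱 : ℤ → Submodule ℝ V)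
    (μ : ∀ n, MultilinearMap ℝ (fun _ : Fin n => V) V) : Prop where
  internal : DirectSum.IsInternal 𝒱
  homogeneous : ∀ n : ℕ, IsHomogeneous 𝒱 𝒱 (μ n) (2 - n)
  relation : ∀ (n : ℕ) (deg : ℕ → ℤ) (a : ℕ → V), (∀ i, a i ∈ 𝒱 (deg i)) →
    ∑ kr ∈ Finset.HasAntidiagonal.antidiagonal (n + 1), gComp (μ kr.1) (μ kr.2) 1 deg a = 0

/-- The maps `F n : V^{⊗ n} → W[1 - n]`, `n ≥ 1`, form an A∞ morphism from `(V, μA)` to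
`(W, μB)`. The value `F 0` is irrelevant. The sum on the left is over all `r` and all
`s₁ + ⋯ + s_r = n` with `s_i ≥ 1`. -/
structure IsAInfMorphism (𝒱 : ℤ → Submodule ℝ V) (𝒲 : ℤ → Submodule ℝ W)
    (μA : ∀ n, MultilinearMap ℝ (fun _ : Fin n => V) V)
    (μB : ∀ n, MultilinearMap ℝ (fun _ : Fin n => W) W)
    (F : ∀ n, MultilinearMap ℝ (fun _ : Fin n => V) W) : Prop where
  source : IsAInfAlgebra 𝒱 μA
  target : IsAInfAlgebra 𝒲 μB
  homogeneous : ∀ n : ℕ, 1 ≤ n → IsHomogeneous 𝒱 𝒲 (F n) (1 - n)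
  relation : ∀ n : ℕ, 1 ≤ n → ∀ (deg : ℕ → ℤ) (a : ℕ → V), (∀ i, a i ∈ 𝒱 (deg i)) →
    ∑ c : Composition n, μB c.length
        (fun i => F (c.blocksFun i) (fun l => a (c.embedding i l))) =
      ∑ m ∈ Finset.Icc 1 n, gComp (F (n - m + 1)) (μA m) 1 deg a

/-- The sum of all `(k, n)`-trees with vertices labelled by `A`: rooted planar trees with `n`
leaves and `k` levels, each level carrying exactly one vertex (the remaining strands are
identities). The vertex of the `l`-th level, counted from the leaves, is decorated by
`A (t l) r`, where `r ≥ 1` is its number of incoming edges; the tree is evaluated on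
`a₁ ⊗ ⋯ ⊗ aₙ`. The `(0, 1)`-tree is the identity and there are no `(0, n)`-trees for `n ≠ 1`. The
recursion is over the position `j` and the arity `r` of the vertex next to the leaves. -/
def treeSum (A : ℝ → ∀ r : ℕ, MultilinearMap ℝ (fun _ : Fin r => V) V) :
    (k n : ℕ) → (Fin k → ℝ) → (ℕ → V) → V
  | 0, n, _, a => if n = 1 then a 0 else 0
  | k + 1, n, t, a => ∑ r ∈ Finset.Icc 1 n, ∑ j ∈ Finset.range (n - r + 1),
      treeSum A k (n - r + 1) (Fin.tail t)
        (insertAt a j r (A (t 0) r fun i : Fin r => a (j + i)))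

end Multilinear

/-- The iterated integral `∫_{p ≤ t₁ ≤ ⋯ ≤ t_k ≤ q} g(t₁, …, t_k)`. For `p > q` it is the oriented
integral over the simplex `p ≥ t₁ ≥ ⋯ ≥ t_k ≥ q`. -/
def simplexIntegral : (k : ℕ) → (p q : ℝ) → ((Fin k → ℝ) → ℝ) → ℝ
  | 0, _, _, g => g Fin.elim0
  | k + 1, p, q, g => ∫ s in p..q, simplexIntegral k s q fun t => g (Fin.cons s t)

/-! ### Local systems, forms and the Maurer–Cartan equation -/

/-- A local system of graded vector spaces on `M` with fibres isomorphic to `(V, 𝒱)`: local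
trivialisations over an open cover, with locally constant transition functions. (The value of
`triv b x` is irrelevant for `x ∉ baseSet b`.) -/
structure LocalSystem (M : Type*) [TopologicalSpace M] {V : Type*} [AddCommGroup V] [Module ℝ V]
    (𝒱 : ℤ → Submodule ℝ V) where
  fiber : M → Type*
  [addCommGroup : ∀ x, AddCommGroup (fiber x)]
  [module : ∀ x, Module ℝ (fiber x)]
  grading : ∀ x, ℤ → Submodule ℝ (fiber x)
  ι : Type*
  baseSet : ι → Set M
  isOpen_baseSet : ∀ b, IsOpen (baseSet b)
  exists_mem_baseSet : ∀ x, ∃ b, x ∈ baseSet b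
  triv : ι → ∀ x, fiber x ≃ₗ[ℝ] V
  triv_mem_iff : ∀ b, ∀ x ∈ baseSet b, ∀ (i : ℤ) (v : fiber x),
    triv b x v ∈ 𝒱 i ↔ v ∈ grading x i
  locallyConstant : ∀ b b', ∀ x ∈ baseSet b ∩ baseSet b', ∀ᶠ y in 𝓝 x, ∀ v : V,
    triv b' y ((triv b y).symm v) = triv b' x ((triv b x).symm v)

attribute [instance] LocalSystem.addCommGroup LocalSystem.module

section Forms

variable {E : Type*} [NormedAddCommGroup E] [NormedSpace ℝ E]
  {H : Type*} [TopologicalSpace H] (I : ModelWithCorners ℝ E H)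
  {M : Type*} [TopologicalSpace M] [ChartedSpace H M]
  {V : Type*} [AddCommGroup V] [Module ℝ V] {𝒱 : ℤ → Submodule ℝ V}

/-- A (not necessarily smooth) differential form on `M` with values in the Hochschild cochains of
the fibres, by components: `α m n` is an `m`-form with values in
`Hom(fiber^{⊗ n}, fiber)`. -/
abbrev HochschildForm (L : LocalSystem M 𝒱) :=
  ∀ (m n : ℕ) (x : M),
    TangentSpace I x [⋀^Fin m]→ₗ[ℝ] MultilinearMap ℝ (fun _ : Fin n => L.fiber x) (L.fiber x)

variable {I} {L : LocalSystem M 𝒱}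

/-- The real `m`-form `⟨φ, α^{m,n}(a₁, …, aₙ)⟩`, where the fibres are identified with `V` by the flat
trivialisation `b`, written in the chart at `x`. -/
def localForm (α : HochschildForm I L) (m n : ℕ) (b : L.ι) (x : M) (φ : Module.Dual ℝ V)
    (a : Fin n → V) (e : E) (v : Fin m → E) : ℝ :=
  φ (L.triv b ((extChartAt I x).symm e)
    (α m n ((extChartAt I x).symm e)
      (fun i => mfderivWithin 𝓘(ℝ, E) I (extChartAt I x).symm (Set.range I) e (v i))
      (fun i => (L.triv b ((extChartAt I x).symm e)).symm (a i))))

/-- Smoothness of the components of `α`. A map into a real vector space without topology (here `V`,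
possibly of infinite dimension) is smooth when its composition with every linear functional is;
such a map has locally values in a finite-dimensional subspace. A map into
`Hom(V^{⊗ n}, V)` is smooth when its value at every `n`-tuple of vectors is. -/
def IsSmooth (α : HochschildForm I L) : Prop :=
  ∀ (m n : ℕ) (b : L.ι), ∀ x ∈ L.baseSet b, ∀ (φ : Module.Dual ℝ V) (a : Fin n → V)
    (v : Fin m → E),
    ContDiffWithinAt ℝ ∞ (fun e => localForm α m n b x φ a e v) (Set.range I) (extChartAt I x x)

/-- The `m`-form component of the covariant exterior derivative `d_∇ α` at `x`, evaluated on
`n` inputs and paired with `φ`: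
`dω(v₀, …, v_m) = ∑_i (-1)^i ∂_{v_i} ω(v₀, …, v̂_i, …, v_m)` in the chart at `x`. -/
def covariantDeriv (α : HochschildForm I L) : (m n : ℕ) → (b : L.ι) → (x : M) →
    (φ : Module.Dual ℝ V) → (a : Fin n → V) → (v : Fin m → TangentSpace I x) → ℝ
  | 0, _, _, _, _, _, _ => 0
  | m + 1, n, b, x, φ, a, v =>
    let w : Fin (m + 1) → E := fun i => mfderiv I 𝓘(ℝ, E) (extChartAt I x) x (v i)
    ∑ i : Fin (m + 1), (-1 : ℝ) ^ (i : ℕ) *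
      fderivWithin ℝ (fun e => localForm α m n b x φ a e (w ∘ i.succAbove)) (Set.range I)
        (extChartAt I x x) (w i)

/-- The `(m, n)` component of the bracket `[α, α]` at `x`, evaluated on tangent vectors `v` and on
homogeneous inputs `a` of degrees `deg`. The bracket of `ω ⊗ f` and `θ ⊗ g` is
`(-1)^{|θ| e_f} ω ∧ θ ⊗ [f, g]`, and
`(ω ∧ θ)(v) = (m₁! m₂!)⁻¹ ∑_σ sgn(σ) ω(v_{σ(1)}, …, v_{σ(m₁)}) θ(v_{σ(m₁+1)}, …, v_{σ(m)})`.
As `α` has total degree one, `α^{m₁,k}` has reduced degree `1 - m₁`. -/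
def selfBracket (α : HochschildForm I L) (m n : ℕ) (x : M) (v : Fin m → TangentSpace I x)
    (deg : ℕ → ℤ) (a : ℕ → L.fiber x) : L.fiber x :=
  ∑ p : Fin (m + 1), ∑ kr ∈ Finset.HasAntidiagonal.antidiagonal (n + 1),
    (((p : ℕ).factorial * (m - (p : ℕ)).factorial : ℕ) : ℝ)⁻¹ •
      ∑ σ : Equiv.Perm (Fin m), ((Equiv.Perm.sign σ : ℤ) : ℝ) •
        (-1 : ℝ) ^ (((m : ℤ) - (p : ℕ)) * (1 - (p : ℕ))) •
          gBracket
            (α (p : ℕ) kr.1 x fun i => v (σ ⟨i, by omega⟩))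
            (α (m - (p : ℕ)) kr.2 x fun i => v (σ ⟨(p : ℕ) + i, by omega⟩))
            (1 - (p : ℕ)) (1 - ((m : ℤ) - (p : ℕ))) deg a

/-- `α` is a smooth form of total degree one, `α^{m,n} ∈ Ω^m(M; Hom(V^{⊗ n}, V[2 - m - n]))`, that
solves the Maurer–Cartan equation `d_∇ α + ½ [α, α] = 0`. -/
structure IsMaurerCartan (α : HochschildForm I L) : Prop where
  smooth : IsSmooth α
  homogeneous : ∀ (m n : ℕ) (x : M) (v : Fin m → TangentSpace I x),
    IsHomogeneous (L.grading x) (L.grading x) (α m n x v) (2 - m - n)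
  equation : ∀ (m n : ℕ) (b : L.ι), ∀ x ∈ L.baseSet b, ∀ (φ : Module.Dual ℝ V)
    (deg : ℕ → ℤ) (a : ℕ → V), (∀ i, a i ∈ 𝒱 (deg i)) → ∀ v : Fin m → TangentSpace I x,
    covariantDeriv α m n b x φ (fun i => a i) v +
      (1 / 2 : ℝ) * φ (L.triv b x
        (selfBracket α m n x v deg fun i => (L.triv b x).symm (a i))) = 0

/-- The structure maps `μ^n_x = α^{0,n}_x` of the A∞ algebra over `x`. -/
def structureMaps (α : HochschildForm I L) (x : M) (n : ℕ) :
    MultilinearMap ℝ (fun _ : Fin n => L.fiber x) (L.fiber x) :=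
  α 0 n x Fin.elim0

/-- A trivialisation of the pull-back of `L` along the path `γ : [0, 1] → M` that is compatible
with the grading and with the flat connection. (Values outside `[0, 1]` are irrelevant.) -/
structure FlatTrivialization (L : LocalSystem M 𝒱) (γ : ℝ → M) where
  toEquiv : ∀ t : ℝ, L.fiber (γ t) ≃ₗ[ℝ] V
  mem_iff : ∀ t ∈ Set.Icc (0 : ℝ) 1, ∀ (i : ℤ) (v : L.fiber (γ t)),
    toEquiv t v ∈ 𝒱 i ↔ v ∈ L.grading (γ t) i
  flat : ∀ b, ∀ t ∈ Set.Icc (0 : ℝ) 1, γ t ∈ L.baseSet b →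
    ∀ᶠ s in 𝓝[Set.Icc (0 : ℝ) 1] t, ∀ v : V,
      L.triv b (γ s) ((toEquiv s).symm v) = L.triv b (γ t) ((toEquiv t).symm v)

/-- The coefficient `α^{1,r}_t : V^{⊗ r} → V` of `dt` in the pull-back of `α^{1,r}` along `γ`, in the
trivialisation `ψ`. -/
def pullbackOne (α : HochschildForm I L) (γ : ℝ → M) (ψ : FlatTrivialization L γ) (t : ℝ) (r : ℕ) :
    MultilinearMap ℝ (fun _ : Fin r => V) V :=
  (ψ.toEquiv t).toLinearMap.compMultilinearMap
    ((α 1 r (γ t) fun _ => mfderivWithin 𝓘(ℝ, ℝ) I γ (Set.Icc 0 1) t (1 : ℝ)).compLinearMap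
      fun _ => (ψ.toEquiv t).symm.toLinearMap)

/-- The maps `F n` from the fibre over `γ p` to the fibre over `γ q` are, in the trivialisation `ψ`,
`F^n = ∑_{i=0}^{n-1+d} (-1)^i ∫_{p ≤ t₁ ≤ ⋯ ≤ t_i ≤ q} (i, n)-trees`, for `n ≥ 1`.
The integral of a `V`-valued function is the vector whose pairing with each linear functional is
the integral of the pairing; there is at most one. -/
def IsTreeIntegral (α : HochschildForm I L) (γ : ℝ → M) (ψ : FlatTrivialization L γ) (d : ℕ)
    (p q : ℝ)
    (F : ∀ n, MultilinearMap ℝ (fun _ : Fin n => L.fiber (γ p)) (L.fiber (γ q))) : Prop :=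
  ∀ n : ℕ, 1 ≤ n → ∀ (a : ℕ → L.fiber (γ p)) (φ : Module.Dual ℝ V),
    φ (ψ.toEquiv q (F n fun i => a i)) =
      ∑ i ∈ Finset.range (n + d), (-1 : ℝ) ^ i * simplexIntegral i p q fun t =>
        φ (treeSum (pullbackOne α γ ψ) i n t fun j => ψ.toEquiv p (a j))

end Forms

end AInfFamily

end

set_option linter.unusedSectionVars false

noncomputable section

namespace AInfFamily

/-! ### Calculus of vector-valued functions tested on linear functionals -/

section WeakCalculus

variable {V : Type*} [AddCommGroup V] [Module ℝ V] {W : Type*} [AddCommGroup W] [Module ℝ W]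

/-! Fix `q` and let the starting point `p` vary. In the flat trivialization let A_t be the
dt-coefficient of the pulled-back 1-form part, μ_t the operations, and F_p the alternating sum of
tree integrals from `p` to `q`. A multilinear function g of lists extends to a coderivation ĝ that
inserts g in all possible positions; precomposing Φ with ĝ is `ins`. Differentiating the iterated
integrals in their lower limit gives F_p' = F_p ∘ Â_p (`transport_wDeriv`), and the 1-form part of
the Maurer–Cartan equation, contracted with the velocity of the path, gives μ_t' = μ_t ∘ Â_t - A_t ∘
μ̂_t (`pathMaps_wDeriv`).

Let D_p = μ_q(F_p, …, F_p) - F_p ∘ μ̂_p be the defect of the morphism equation. The Leibniz rule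
with `ins_cmp` handles its first term, the commutator of two coderivations (`ins_comp_map`) its
second, and together D_p' = D_p ∘ Â_p. Since A has no unary component, the right side involves D_p
only on shorter lists, where it vanishes by induction on the number of inputs. So D is constant in
`p`. At `p = q` the transport is the identity, hence D_q = μ_q - μ_q = 0; this is `transport_cmp`.
The missing unary component also forces a tree with k levels to have more than k leaves, so the
extra `d` terms vanish.

Koszul signs are carried by a linear map ε acting on degree i by (-1)^(i-1) and applied to all
entries to the left of an inserted μ. As A has reduced degree 0 it commutes with ε, and no other
sign enters the computation. The space V has no topology, so continuity, derivatives and integrals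
are tested on functionals; the product rule survives because a weakly continuous function on [0, 1]
has finite-dimensional span. -/

/-- Continuity on `[0, 1]` of all pairings with linear functionals. -/
def WCont (f : ℝ → V) : Prop :=
  ∀ φ : Module.Dual ℝ V, ContinuousOn (fun t => φ (f t)) (Set.Icc 0 1)

/-- `f'` is the derivative of `f` on `[0, 1]`, tested against all linear functionals. -/
def WDeriv (f f' : ℝ → V) : Prop :=
  ∀ φ : Module.Dual ℝ V, ∀ t ∈ Set.Icc (0 : ℝ) 1,
    HasDerivWithinAt (fun t => φ (f t)) (φ (f' t)) (Set.Icc 0 1) t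

theorem dual_ext {x y : V} (h : ∀ φ : Module.Dual ℝ V, φ x = φ y) : x = y := by
  rw [← sub_eq_zero, ← Module.forall_dual_apply_eq_zero_iff ℝ]
  intro φ
  rw [map_sub, h, sub_self]

theorem WDeriv.wCont {f f' : ℝ → V} (h : WDeriv f f') : WCont f :=
  fun φ t ht => (h φ t ht).continuousWithinAt

theorem WCont.const (x : V) : WCont fun _ => x := fun _ => continuousOn_const

theorem WCont.add {f g : ℝ → V} (hf : WCont f) (hg : WCont g) : WCont fun t => f t + g t :=
  fun φ => by simpa using (hf φ).fun_add (hg φ)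

theorem WCont.congr {f g : ℝ → V} (hf : WCont f) (h : ∀ t ∈ Set.Icc (0 : ℝ) 1, g t = f t) :
    WCont g :=
  fun φ => (hf φ).congr fun t ht => by rw [h t ht]

theorem WDeriv.const (x : V) : WDeriv (fun _ => x) fun _ => 0 := fun φ t _ => by
  simpa using hasDerivWithinAt_const t (Set.Icc (0 : ℝ) 1) (φ x)

theorem WDeriv.add {f f' g g' : ℝ → V} (hf : WDeriv f f') (hg : WDeriv g g') :
    WDeriv (fun t => f t + g t) fun t => f' t + g' t :=
  fun φ t ht => by simpa using (hf φ t ht).fun_add (hg φ t ht)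

theorem WDeriv.sub {f f' g g' : ℝ → V} (hf : WDeriv f f') (hg : WDeriv g g') :
    WDeriv (fun t => f t - g t) fun t => f' t - g' t :=
  fun φ t ht => by simpa using (hf φ t ht).fun_sub (hg φ t ht)

theorem WDeriv.sum {ι : Type*} {s : Finset ι} {f f' : ι → ℝ → V}
    (hf : ∀ i ∈ s, WDeriv (f i) (f' i)) :
    WDeriv (fun t => ∑ i ∈ s, f i t) fun t => ∑ i ∈ s, f' i t :=
  fun φ t ht => by simpa using HasDerivWithinAt.fun_sum fun i hi => hf i hi φ t ht

theorem WDeriv.congr {f f' g g' : ℝ → V} (hf : WDeriv f f')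
    (h : ∀ t ∈ Set.Icc (0 : ℝ) 1, g t = f t) (h' : ∀ t ∈ Set.Icc (0 : ℝ) 1, g' t = f' t) :
    WDeriv g g' := fun φ t ht => by
  rw [h' t ht]
  exact (hf φ t ht).congr (fun s hs => by rw [h s hs]) (by rw [h t ht])

theorem WDeriv.map {f f' : ℝ → V} (hf : WDeriv f f') (g : V →ₗ[ℝ] W) :
    WDeriv (fun t => g (f t)) fun t => g (f' t) :=
  fun φ => hf (φ ∘ₗ g)

/-- A family of vectors on which every linear functional is bounded lies in a finite-dimensional
subspace. -/
theorem finiteDimensional_span_of_bounded {X : Type*} (f : X → V)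
    (h : ∀ φ : Module.Dual ℝ V, ∃ C, ∀ x, φ (f x) ≤ C) :
    FiniteDimensional ℝ (Submodule.span ℝ (Set.range f)) := by
  obtain ⟨κ, a, -, hs, hl⟩ := exists_linearIndependent' ℝ f
  rw [← hs]
  suffices Finite κ from FiniteDimensional.span_of_finite ℝ (Set.finite_range _)
  by_contra hκ
  rw [not_finite_iff_infinite] at hκ
  -- On an infinite independent subfamily some functional takes the value k at the k-th member, so
  -- it is unbounded.
  have hli := hl.comp _ (Infinite.natEmbedding κ).injective
  obtain ⟨φ, hφ⟩ := ((Module.Basis.span hli).constr ℝ fun k : ℕ => (k : ℝ)).exists_extend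
  obtain ⟨C, hC⟩ := h φ
  obtain ⟨k, hk⟩ := exists_nat_gt C
  refine (hC (a (Infinite.natEmbedding κ k))).not_gt (hk.trans_eq ?_)
  have h1 := LinearMap.congr_fun hφ (Module.Basis.span hli k)
  rw [Module.Basis.constr_basis, LinearMap.comp_apply, Submodule.subtype_apply,
    Module.Basis.span_apply] at h1
  exact h1.symm

/-- Compactness of [0, 1] bounds every functional on the image of `f`, so the image spans a
finite-dimensional subspace. A linear retraction onto it extends its coordinate functionals to all
of `V`. -/
theorem WCont.exists_expansion {f : ℝ → V} (hf : WCont f) :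
    ∃ (n : ℕ) (φ : Fin n → Module.Dual ℝ V) (w : Fin n → V),
      ∀ t ∈ Set.Icc (0 : ℝ) 1, f t = ∑ i, φ i (f t) • w i := by
  have hfin := finiteDimensional_span_of_bounded (fun t : Set.Icc (0 : ℝ) 1 => f t) fun φ => by
    obtain ⟨C, hC⟩ := isCompact_Icc.bddAbove_image (hf φ)
    exact ⟨C, fun x => hC ⟨x, x.2, rfl⟩⟩
  set S := Submodule.span ℝ (Set.range fun t : Set.Icc (0 : ℝ) 1 => f t)
  obtain ⟨P, hP⟩ := S.subtype.exists_leftInverse_of_injective S.ker_subtype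
  let b := Module.finBasis ℝ S
  refine ⟨_, fun i => b.coord i ∘ₗ P, fun i => b i, fun t ht => ?_⟩
  have hm : f t ∈ S := Submodule.subset_span ⟨⟨t, ht⟩, rfl⟩
  have h1 : P (f t) = ⟨f t, hm⟩ := LinearMap.congr_fun hP ⟨f t, hm⟩
  have h3 := congrArg S.subtype (b.sum_repr ⟨f t, hm⟩)
  rw [map_sum] at h3
  simpa only [LinearMap.comp_apply, h1, Submodule.subtype_apply, Module.Basis.coord_apply, map_smul] using h3.symm

/-- Every functional of `f` is a fixed combination of the coordinates, so uniqueness of derivatives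
on an interval carries the expansion over to `f'`. -/
theorem WDeriv.expansion {f f' : ℝ → V} (hf : WDeriv f f') {n : ℕ} {φ : Fin n → Module.Dual ℝ V}
    {w : Fin n → V} (h : ∀ t ∈ Set.Icc (0 : ℝ) 1, f t = ∑ i, φ i (f t) • w i) {t : ℝ}
    (ht : t ∈ Set.Icc (0 : ℝ) 1) : f' t = ∑ i, φ i (f' t) • w i := by
  refine dual_ext fun χ => ?_
  have h1 : HasDerivWithinAt (fun t => χ (f t)) (∑ i, φ i (f' t) * χ (w i)) (Set.Icc 0 1) t := by
    have h2 : HasDerivWithinAt (fun t => ∑ i, φ i (f t) * χ (w i)) (∑ i, φ i (f' t) * χ (w i))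
        (Set.Icc 0 1) t := HasDerivWithinAt.fun_sum fun i _ => (hf (φ i) t ht).mul_const _
    have h3 : ∀ s ∈ Set.Icc (0 : ℝ) 1, χ (f s) = ∑ i, φ i (f s) * χ (w i) := fun s hs => by
      conv_lhs => rw [h s hs]
      simp
    exact h2.congr h3 (h3 t ht)
  have := (uniqueDiffOn_Icc zero_lt_one t ht).eq_deriv _ (hf χ t ht) h1
  simpa using this

theorem WCont.apply {B : ℝ → V →ₗ[ℝ] W} (hB : ∀ x, WCont fun t => B t x) {f : ℝ → V}
    (hf : WCont f) : WCont fun t => B t (f t) := by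
  obtain ⟨n, χ, w, h⟩ := hf.exists_expansion
  intro φ
  have : ContinuousOn (fun t => ∑ i, χ i (f t) * φ (B t (w i))) (Set.Icc 0 1) :=
    continuousOn_finsetSum _ fun i _ => (hf (χ i)).mul (hB (w i) φ)
  refine this.congr fun t ht => ?_
  change φ (B t (f t)) = _
  conv_lhs => rw [h t ht]
  simp

/-- The operators are differentiable only at each fixed vector. Expanding `f` in finitely many fixed
vectors with scalar coefficients reduces this to the scalar product rule. -/
theorem WDeriv.apply {B B' : ℝ → V →ₗ[ℝ] W} (hB : ∀ x, WDeriv (fun t => B t x) fun t => B' t x)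
    {f f' : ℝ → V} (hf : WDeriv f f') :
    WDeriv (fun t => B t (f t)) fun t => B' t (f t) + B t (f' t) := by
  obtain ⟨n, χ, w, h⟩ := hf.wCont.exists_expansion
  intro φ t ht
  have h1 : HasDerivWithinAt (fun t => ∑ i, χ i (f t) * φ (B t (w i)))
      (∑ i, (χ i (f' t) * φ (B t (w i)) + χ i (f t) * φ (B' t (w i)))) (Set.Icc 0 1) t :=
    HasDerivWithinAt.fun_sum fun i _ => (hf (χ i) t ht).mul (hB (w i) φ t ht)
  have h2 : ∀ s ∈ Set.Icc (0 : ℝ) 1, φ (B s (f s)) = ∑ i, χ i (f s) * φ (B s (w i)) :=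
    fun s hs => by
      conv_lhs => rw [h s hs]
      simp
  refine (h1.congr h2 (h2 t ht)).congr_deriv ?_
  change _ = φ (B' t (f t) + B t (f' t))
  conv_rhs => rw [h t ht, hf.expansion h ht]
  simp [Finset.sum_add_distrib, add_comm]

theorem WDeriv.eq_const {f f' : ℝ → V} (hf : WDeriv f f')
    (h0 : ∀ t ∈ Set.Icc (0 : ℝ) 1, f' t = 0) {p q : ℝ} (hp : p ∈ Set.Icc (0 : ℝ) 1)
    (hq : q ∈ Set.Icc (0 : ℝ) 1) : f p = f q := by
  refine dual_ext fun φ => ?_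
  have := (convex_Icc (0 : ℝ) 1).norm_image_sub_le_of_norm_hasDerivWithin_le (C := 0)
    (fun t ht => hf φ t ht) (fun t ht => by simp [h0 t ht]) hq hp
  simpa [sub_eq_zero] using this

/-! ### Integrals defined by pairing with functionals -/

open Classical in
/-- The vector that pairs with every linear functional to the integral of the pairing. -/
def wInt (p q : ℝ) (f : ℝ → V) : V :=
  if h : ∃ v, ∀ φ : Module.Dual ℝ V, φ v = ∫ s in p..q, φ (f s) then h.choose else 0

theorem WCont.intervalIntegrable {f : ℝ → V} (hf : WCont f) {p q : ℝ}
    (hp : p ∈ Set.Icc (0 : ℝ) 1) (hq : q ∈ Set.Icc (0 : ℝ) 1) (φ : Module.Dual ℝ V) :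
    IntervalIntegrable (fun s => φ (f s)) MeasureTheory.volume p q :=
  ((hf φ).mono (Set.uIcc_subset_Icc hp hq)).intervalIntegrable

/-- A finite expansion of `f` exhibits the integral as a vector, so the default value 0 is not taken
for weakly continuous functions. -/
theorem WCont.wInt_spec {f : ℝ → V} (hf : WCont f) {p q : ℝ} (hp : p ∈ Set.Icc (0 : ℝ) 1)
    (hq : q ∈ Set.Icc (0 : ℝ) 1) (φ : Module.Dual ℝ V) :
    φ (wInt p q f) = ∫ s in p..q, φ (f s) := by
  have h : ∃ v, ∀ φ : Module.Dual ℝ V, φ v = ∫ s in p..q, φ (f s) := by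
    obtain ⟨n, χ, w, h⟩ := hf.exists_expansion
    refine ⟨∑ i, (∫ s in p..q, χ i (f s)) • w i, fun φ => ?_⟩
    have h1 : ∫ s in p..q, φ (f s) = ∫ s in p..q, ∑ i, χ i (f s) * φ (w i) := by
      refine intervalIntegral.integral_congr fun s hs => ?_
      conv_lhs => rw [h s (Set.uIcc_subset_Icc hp hq hs)]
      simp
    rw [h1, intervalIntegral.integral_finsetSum fun i _ =>
      (hf.intervalIntegrable hp hq (χ i)).mul_const _]
    simp
  rw [wInt, dif_pos h]
  exact h.choose_spec φ

theorem WCont.wDeriv_wInt {f : ℝ → V} (hf : WCont f) {q : ℝ} (hq : q ∈ Set.Icc (0 : ℝ) 1) :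
    WDeriv (fun p => wInt p q f) fun p => -f p := by
  intro φ t ht
  have : Fact (t ∈ Set.Icc (0 : ℝ) 1) := ⟨ht⟩
  have h1 : HasDerivWithinAt (fun p => ∫ s in p..q, φ (f s)) (-φ (f t)) (Set.Icc 0 1) t :=
    intervalIntegral.integral_hasDerivWithinAt_left (hf.intervalIntegrable ht hq φ)
      ((hf φ).stronglyMeasurableAtFilter_nhdsWithin measurableSet_Icc t) ((hf φ) t ht)
  rw [map_neg]
  exact h1.congr (fun s hs => hf.wInt_spec hs hq φ) (hf.wInt_spec ht hq φ)

/-- A vector outside a subspace is detected by a functional that kills the subspace. This keeps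
integrals in the correct degree. -/
theorem WCont.wInt_mem {f : ℝ → V} (hf : WCont f) {p q : ℝ} (hp : p ∈ Set.Icc (0 : ℝ) 1)
    (hq : q ∈ Set.Icc (0 : ℝ) 1) {S : Submodule ℝ V} (h : ∀ t ∈ Set.Icc (0 : ℝ) 1, f t ∈ S) :
    wInt p q f ∈ S := by
  by_contra hn
  obtain ⟨φ, hφ, hS⟩ := S.exists_le_ker_of_notMem hn
  refine hφ ?_
  rw [hf.wInt_spec hp hq]
  rw [intervalIntegral.integral_congr (g := fun _ => 0), intervalIntegral.integral_zero]
  exact fun s hs => hS (h s (Set.uIcc_subset_Icc hp hq hs))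

theorem wInt_self (q : ℝ) (f : ℝ → V) : wInt q q f = 0 := by
  have h : ∃ v, ∀ φ : Module.Dual ℝ V, φ v = ∫ s in q..q, φ (f s) := ⟨0, by simp⟩
  rw [wInt, dif_pos h]
  exact dual_ext fun φ => by simpa using h.choose_spec φ

end WeakCalculus

/-! ### Multilinear functions of finite lists -/

section ListFunctions

variable {V : Type*} [AddCommGroup V] [Module ℝ V] {W : Type*} [AddCommGroup W] [Module ℝ W]
  {Z : Type*} [AddCommGroup Z] [Module ℝ Z]

/-- A function of finite lists of vectors that is linear in each entry. -/
def IsML (Φ : List V → W) : Prop :=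
  ∀ l₁ l₂ : List V, IsLinearMap ℝ fun x => Φ (l₁ ++ x :: l₂)

theorem IsML.append {Φ : List V → W} (h : IsML Φ) (v : List V) : IsML fun l => Φ (v ++ l) :=
  fun l₁ l₂ => by simpa using h (v ++ l₁) l₂

theorem IsML.cons {Φ : List V → W} (h : IsML Φ) (x : V) : IsML fun l => Φ (x :: l) :=
  h.append [x]

/-- A multilinear function of lists as a linear map in its first entry. -/
def IsML.head {Φ : List V → W} (h : IsML Φ) (u : List V) : V →ₗ[ℝ] W := (h [] u).mk' _

@[simp] theorem IsML.head_apply {Φ : List V → W} (h : IsML Φ) (u : List V) (x : V) :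
    h.head u x = Φ (x :: u) := rfl

theorem isLinearMap_zero : IsLinearMap ℝ fun _ : V => (0 : W) := ⟨by simp, by simp⟩

theorem isLinearMap_add {f g : V → W} (hf : IsLinearMap ℝ f) (hg : IsLinearMap ℝ g) :
    IsLinearMap ℝ fun x => f x + g x := (hf.mk' + hg.mk').isLinear

theorem isLinearMap_sub {f g : V → W} (hf : IsLinearMap ℝ f) (hg : IsLinearMap ℝ g) :
    IsLinearMap ℝ fun x => f x - g x := (hf.mk' - hg.mk').isLinear

theorem isLinearMap_smul (c : ℝ) {f : V → W} (hf : IsLinearMap ℝ f) :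
    IsLinearMap ℝ fun x => c • f x := (c • hf.mk').isLinear

theorem isLinearMap_comp {g : W → Z} {f : V → W} (hg : IsLinearMap ℝ g) (hf : IsLinearMap ℝ f) :
    IsLinearMap ℝ fun x => g (f x) := (hg.mk' ∘ₗ hf.mk').isLinear

theorem isLinearMap_sum {ι : Type*} (s : Finset ι) {f : ι → V → W}
    (h : ∀ i ∈ s, IsLinearMap ℝ (f i)) : IsLinearMap ℝ fun x => ∑ i ∈ s, f i x :=
  ⟨fun x y => by rw [← Finset.sum_add_distrib]; exact Finset.sum_congr rfl fun i hi => (h i hi).1 x y,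
   fun c x => by rw [Finset.smul_sum]; exact Finset.sum_congr rfl fun i hi => (h i hi).2 c x⟩

theorem IsML.sub {Φ Ψ : List V → W} (h : IsML Φ) (h' : IsML Ψ) : IsML fun l => Φ l - Ψ l :=
  fun l₁ l₂ => isLinearMap_sub (h l₁ l₂) (h' l₁ l₂)

theorem IsML.zero_mem {Φ : List V → W} (h : IsML Φ) {l : List V} (hl : (0 : V) ∈ l) : Φ l = 0 := by
  obtain ⟨l₁, l₂, rfl⟩ := List.append_of_mem hl
  exact (h l₁ l₂).map_zero

/-- The sum of `K v u` over all decompositions `l = v ++ u`. -/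
def spl (K : List V → List V → W) : List V → W
  | [] => K [] []
  | x :: w => K [] (x :: w) + spl (fun v u => K (x :: v) u) w

/-- The sum of `K v u` over all decompositions `l = v ++ u` with `v ≠ []`. -/
def splNe (K : List V → List V → W) : List V → W
  | [] => 0
  | x :: w => spl (fun v u => K (x :: v) u) w

theorem spl_eq (K : List V → List V → W) (l : List V) : spl K l = K [] l + splNe K l := by
  cases l <;> simp [spl, splNe]

theorem spl_add (K K' : List V → List V → W) (l : List V) :
    spl (fun v u => K v u + K' v u) l = spl K l + spl K' l := by
  induction l generalizing K K' with
  | nil => rfl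
  | cons x w ih => simp only [spl, ih]; abel

theorem splNe_add (K K' : List V → List V → W) (l : List V) :
    splNe (fun v u => K v u + K' v u) l = splNe K l + splNe K' l := by
  cases l with
  | nil => simp [splNe]
  | cons x w => exact spl_add _ _ _

theorem spl_congr {K K' : List V → List V → W} {l : List V}
    (h : ∀ v u, l = v ++ u → K v u = K' v u) : spl K l = spl K' l := by
  induction l generalizing K K' with
  | nil => exact h [] [] rfl
  | cons x w ih =>
    rw [spl, spl, h [] _ rfl, ih fun v u e => h (x :: v) u (by rw [e]; rfl)]

theorem splNe_congr {K K' : List V → List V → W} {l : List V}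
    (h : ∀ v u, v ≠ [] → l = v ++ u → K v u = K' v u) : splNe K l = splNe K' l := by
  cases l with
  | nil => rfl
  | cons x w => exact spl_congr fun v u e => h (x :: v) u (by simp) (by rw [e]; rfl)

theorem splNe_eq_zero {K : List V → List V → W} {l : List V}
    (h : ∀ v u, v ≠ [] → l = v ++ u → K v u = 0) : splNe K l = 0 := by
  have h0 : ∀ l : List V, spl (fun _ _ => (0 : W)) l = 0 := fun l => by
    induction l with
    | nil => rfl
    | cons x w ih => simp [spl, ih]
  rw [splNe_congr (K' := fun _ _ => 0) h]
  cases l with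
  | nil => rfl
  | cons x w => exact h0 w

theorem map_spl {g : W → Z} (hg : IsLinearMap ℝ g) (K : List V → List V → W) (l : List V) :
    g (spl K l) = spl (fun v u => g (K v u)) l := by
  induction l generalizing K with
  | nil => rfl
  | cons x w ih => rw [spl, hg.1, ih]; rfl

theorem map_splNe {g : W → Z} (hg : IsLinearMap ℝ g) (K : List V → List V → W) (l : List V) :
    g (splNe K l) = splNe (fun v u => g (K v u)) l := by
  cases l with
  | nil => exact hg.map_zero
  | cons x w => exact map_spl hg _ w

theorem isLinearMap_spl {K : Z → List V → List V → W} {l : List V}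
    (h : ∀ v u, l = v ++ u → IsLinearMap ℝ fun z => K z v u) :
    IsLinearMap ℝ fun z => spl (K z) l := by
  induction l generalizing K with
  | nil => exact h [] [] rfl
  | cons x w ih =>
    exact isLinearMap_add (h [] _ rfl) (ih fun v u e => h (x :: v) u (by rw [e]; rfl))

theorem isLinearMap_splNe {K : Z → List V → List V → W} {l : List V}
    (h : ∀ v u, v ≠ [] → l = v ++ u → IsLinearMap ℝ fun z => K z v u) :
    IsLinearMap ℝ fun z => splNe (K z) l := by
  cases l with
  | nil => exact isLinearMap_zero
  | cons x w =>
    exact isLinearMap_spl fun v u e => h (x :: v) u (by simp) (by rw [e]; rfl)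

theorem IsML.spl {K : List V → List V → W} (h₁ : ∀ u, IsML fun v => K v u)
    (h₂ : ∀ v, IsML (K v)) : IsML (spl K) := by
  intro l₁ l₂
  induction l₁ generalizing K with
  | nil =>
    exact isLinearMap_add (h₂ [] [] l₂) (isLinearMap_spl fun v u _ => h₁ u [] v)
  | cons y l₁ ih =>
    exact isLinearMap_add (h₂ [] (y :: l₁) l₂) (ih (fun u => (h₁ u).cons y) fun v => h₂ (y :: v))

theorem IsML.splNe {K : List V → List V → W} (h₁ : ∀ u, IsML fun v => K v u)
    (h₂ : ∀ v, v ≠ [] → IsML (K v)) : IsML (splNe K) := by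
  intro l₁ l₂
  cases l₁ with
  | nil => exact isLinearMap_spl fun v u _ => h₁ u [] v
  | cons y l₁ =>
    exact IsML.spl (fun u => (h₁ u).cons y) (fun v => h₂ (y :: v) (by simp)) l₁ l₂

/-- The sum of `Φ (σ l₁ ++ g l₂ :: l₃)` over all decompositions `l = l₁ ++ l₂ ++ l₃` with
`l₂ ≠ []`, where `σ` is applied to all entries of `l₁`. -/
def ins (σ : V →ₗ[ℝ] V) (g : List V → V) (Φ : List V → W) : List V → W
  | [] => 0
  | x :: w => splNe (fun v u => Φ (g v :: u)) (x :: w) + ins σ g (fun l => Φ (σ x :: l)) w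

variable {σ τ : V →ₗ[ℝ] V} {g g' : List V → V}

theorem ins_add (Φ Φ' : List V → W) (l : List V) :
    ins σ g (fun l => Φ l + Φ' l) l = ins σ g Φ l + ins σ g Φ' l := by
  induction l generalizing Φ Φ' with
  | nil => simp [ins]
  | cons x w ih => simp only [ins, ih, splNe_add]; abel

theorem map_ins {f : W → Z} (hf : IsLinearMap ℝ f) (Φ : List V → W) (l : List V) :
    f (ins σ g Φ l) = ins σ g (fun l => f (Φ l)) l := by
  induction l generalizing Φ with
  | nil => exact hf.map_zero
  | cons x w ih => rw [ins, hf.1, ih, map_splNe hf]; rfl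

theorem ins_congr {Φ Φ' : List V → W} {l : List V}
    (h : ∀ l₁ l₂ l₃, l₂ ≠ [] → l = l₁ ++ l₂ ++ l₃ →
      Φ (l₁.map σ ++ g l₂ :: l₃) = Φ' (l₁.map σ ++ g l₂ :: l₃)) :
    ins σ g Φ l = ins σ g Φ' l := by
  induction l generalizing Φ Φ' with
  | nil => rfl
  | cons x w ih =>
    rw [ins, ins, splNe_congr (K := fun v u => Φ (g v :: u)) (K' := fun v u => Φ' (g v :: u)) fun v u hv e => h [] v u hv e,
      ih (Φ' := fun l => Φ' (σ x :: l)) fun l₁ l₂ l₃ hl e => h (x :: l₁) l₂ l₃ hl (by rw [e]; rfl)]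

theorem ins_zero (l : List V) : ins σ g (fun _ => (0 : W)) l = 0 := by
  induction l with
  | nil => rfl
  | cons x w ih => rw [ins, ih, splNe_eq_zero fun _ _ _ _ => rfl, add_zero]

theorem ins_eq_zero {Φ : List V → W} {l : List V}
    (h : ∀ l₁ l₂ l₃, l₂ ≠ [] → l = l₁ ++ l₂ ++ l₃ → Φ (l₁.map σ ++ g l₂ :: l₃) = 0) :
    ins σ g Φ l = 0 := (ins_congr h).trans (ins_zero l)

theorem isLinearMap_ins {Φ : Z → List V → W} (h : ∀ l, IsLinearMap ℝ fun z => Φ z l) (l : List V) :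
    IsLinearMap ℝ fun z => ins σ g (Φ z) l := by
  induction l generalizing Φ with
  | nil => exact isLinearMap_zero
  | cons x w ih =>
    exact isLinearMap_add (isLinearMap_splNe fun v u _ _ => h _) (ih fun l => h _)

theorem IsML.ins (hg : IsML g) {Φ : List V → W} (hΦ : IsML Φ) : IsML (ins σ g Φ) := by
  have key : ∀ {Φ : List V → W}, IsML Φ → IsML (AInfFamily.splNe fun v u => Φ (g v :: u)) :=
    fun {Φ} hΦ => IsML.splNe (fun u l₁ l₂ => isLinearMap_comp (g := fun z => Φ (z :: u)) (hΦ [] u) (hg l₁ l₂))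
      fun v _ => hΦ.cons (g v)
  intro l₁ l₂
  induction l₁ generalizing Φ with
  | nil =>
    refine isLinearMap_add (key hΦ [] l₂) ?_
    exact isLinearMap_ins (fun l => isLinearMap_comp (g := fun z => Φ (z :: l)) (hΦ [] l) σ.isLinear) l₂
  | cons y l₁ ih =>
    exact isLinearMap_add (key hΦ (y :: l₁) l₂) (ih (hΦ.cons (σ y)))

theorem ins_sub_left {Φ : List V → W} (hΦ : IsML Φ) (l : List V) :
    ins σ (fun l => g l - g' l) Φ l = ins σ g Φ l - ins σ g' Φ l := by
  have key : ∀ (Φ : List V → W), IsML Φ → ∀ l, splNe (fun v u => Φ ((g v - g' v) :: u)) l +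
      splNe (fun v u => Φ (g' v :: u)) l = splNe (fun v u => Φ (g v :: u)) l := fun Φ hΦ l => by
    rw [← splNe_add]
    refine splNe_congr fun v u _ _ => ?_
    have := (hΦ [] u).map_sub (g v) (g' v)
    simp only [List.nil_append] at this
    rw [this, sub_add_cancel]
  induction l generalizing Φ with
  | nil => simp [ins]
  | cons x w ih =>
    simp only [ins, ih (hΦ.cons (σ x)), ← key Φ hΦ]
    abel

/-- Coassociativity of deconcatenation: both sides sum over all cuts of `l` into three pieces. -/
theorem spl_assoc (T : List V → List V → List V → W) (l : List V) :
    spl (fun v u => spl (fun v' u' => T v v' u') u) l =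
      spl (fun v u => spl (fun v₁ v₂ => T v₁ v₂ u) v) l := by
  induction l generalizing T with
  | nil => rfl
  | cons x w ih => simp only [spl, ih, spl_add, add_assoc]

/-- Insertions are coderivations of the deconcatenation coproduct. -/
theorem ins_spl (K : List V → List V → W) (l : List V) :
    ins σ g (spl K) l = spl (fun v u => ins σ g (fun v => K v u) v) l +
      spl (fun v u => ins σ g (K (v.map σ)) u) l := by
  induction l generalizing K with
  | nil => simp [ins, spl]
  | cons x w ih =>
    have h := spl_assoc (fun v v' u => K (g (x :: v) :: v') u) w
    simp only [ins, spl, splNe, spl_add, ins_add, ih, List.map_nil, List.map_cons] at h ⊢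
    rw [h]
    abel

theorem ins_splNe (K : List V → List V → W) (l : List V) :
    ins σ g (splNe K) l = splNe (fun v u => ins σ g (fun v => K v u) v) l +
      splNe (fun v u => ins σ g (K (v.map σ)) u) l := by
  have h := ins_spl (σ := σ) (g := g) K l
  have h1 : ins σ g (spl K) l = ins σ g (K []) l + ins σ g (splNe K) l := by
    rw [← ins_add]; congr 1; ext l; exact spl_eq K l
  rw [h1, spl_eq, spl_eq] at h
  simp only [ins, List.map_nil, zero_add] at h
  rw [add_left_comm] at h
  exact add_left_cancel h

/-- The commutator of two coderivations is the coderivation of the commutator. Insertions of `A` and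
`μ` in disjoint blocks occur in both orders and cancel; `hA` is what allows this when `A` acts to
the left of `μ`, on entries already modified by `σ`. Only the nested insertions remain. -/
theorem ins_comp_map {Φ : List V → W} {A : List V → V}
    (hA : ∀ l, A (l.map σ) = σ (A l)) (μ : List V → V) (hΦ : IsML Φ) (l : List V) :
    ins σ μ (ins .id A Φ) l + ins σ (fun l => ins .id A μ l - ins σ μ A l) Φ l =
      ins .id A (ins σ μ Φ) l := by
  rw [ins_sub_left hΦ]
  induction l generalizing Φ with
  | nil => simp [ins]
  | cons x w ih =>
    have e1 : ∀ l, splNe (fun v u => ins .id A Φ (μ v :: u)) l =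
        splNe (fun v u => splNe (fun v u => Φ (A v :: u)) (μ v :: u)) l +
        splNe (fun v u => ins .id A (fun l => Φ (μ v :: l)) u) l := fun l => by
      rw [← splNe_add]; rfl
    have e2 : ∀ l, splNe (fun v u => ins σ μ Φ (A v :: u)) l =
        splNe (fun v u => splNe (fun v u => Φ (μ v :: u)) (A v :: u)) l +
        splNe (fun v u => ins σ μ (fun l => Φ (σ (A v) :: l)) u) l := fun l => by
      rw [← splNe_add]; rfl
    -- With the `A`-block as a prefix, `μ` is inserted either inside that block or to its right; the
    -- second case is a disjoint pair. The next identity is the same with the roles exchanged.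
    have c1 : ins σ μ (splNe fun v u => Φ (A v :: u)) (x :: w) =
        splNe (fun v u => Φ (ins σ μ A v :: u)) (x :: w) +
          splNe (fun v u => ins σ μ (fun l => Φ (σ (A v) :: l)) u) (x :: w) := by
      rw [ins_splNe]
      congr 1
      · refine splNe_congr fun v u _ _ => ?_
        exact (map_ins (hΦ [] u) A v).symm
      · simp only [hA]
    have c2 : ins .id A (splNe fun v u => Φ (μ v :: u)) (x :: w) =
        splNe (fun v u => Φ (ins .id A μ v :: u)) (x :: w) +
          splNe (fun v u => ins .id A (fun l => Φ (μ v :: l)) u) (x :: w) := by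
      rw [ins_splNe]
      congr 1
      · refine splNe_congr fun v u _ _ => ?_
        exact (map_ins (hΦ [] u) μ v).symm
      · simp
    have f1 : ∀ l, ins .id A Φ (σ x :: l) = splNe (fun v u => Φ (A v :: u)) (σ x :: l) +
      ins .id A (fun l => Φ (σ x :: l)) l := fun l => rfl
    have f2 : ∀ l, ins σ μ Φ (x :: l) = splNe (fun v u => Φ (μ v :: u)) (x :: l) +
      ins σ μ (fun l => Φ (σ x :: l)) l := fun l => rfl
    have i1 := ih (hΦ.cons (σ x))
    rw [ins] at c1 c2
    simp only [LinearMap.id_apply] at c2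
    rw [ins, ins, ins, ins, e1, e2]
    simp only [f1, f2, LinearMap.id_apply, ins_add]
    linear_combination (norm := module) i1 + c1 - c2

/-- The sum of `Ψ [F b₁, …, F b_r]` over all decompositions of a list into nonempty blocks
`b₁, …, b_r`. -/
def cmp (F : List V → Z) (Ψ : List Z → W) : List V → W
  | [] => Ψ []
  | x :: w => ∑ i : Fin (w.length + 1),
      cmp F (fun l => Ψ (F (x :: w.take i) :: l)) (w.drop i)
termination_by l => l.length
decreasing_by simp

/-- The sum of `Ψ [F b₁, …, F' b_i, …, F b_r]` over all decompositions of a list into nonempty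
blocks `b₁, …, b_r` and all `i`. -/
def dcmp (F F' : List V → Z) (Ψ : List Z → W) : List V → W
  | [] => 0
  | x :: w => ∑ i : Fin (w.length + 1),
      (cmp F (fun l => Ψ (F' (x :: w.take i) :: l)) (w.drop i) +
        dcmp F F' (fun l => Ψ (F (x :: w.take i) :: l)) (w.drop i))
termination_by l => l.length
decreasing_by simp

theorem spl_eq_sum (K : List V → List V → W) (l : List V) :
    spl K l = ∑ i ∈ Finset.range (l.length + 1), K (l.take i) (l.drop i) := by
  induction l generalizing K with
  | nil => simp [spl]
  | cons x w ih =>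
    rw [spl, ih, List.length_cons, Finset.sum_range_succ' _ (w.length + 1), add_comm]
    rfl

variable {F F' : List V → Z}

theorem cmp_eq {Ψ : List Z → W} {l : List V} (hl : l ≠ []) :
    cmp F Ψ l = splNe (fun v u => cmp F (fun l => Ψ (F v :: l)) u) l := by
  obtain ⟨x, w, rfl⟩ := List.exists_cons_of_ne_nil hl
  rw [cmp, splNe, spl_eq_sum, Finset.sum_range]

theorem dcmp_eq (Ψ : List Z → W) (l : List V) :
    dcmp F F' Ψ l = splNe (fun v u => cmp F (fun l => Ψ (F' v :: l)) u +
      dcmp F F' (fun l => Ψ (F v :: l)) u) l := by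
  cases l with
  | nil => rw [dcmp, splNe]
  | cons x w => rw [dcmp, splNe, spl_eq_sum, Finset.sum_range]

theorem length_lt_of_append {v u l : List V} (hv : v ≠ []) (e : l = v ++ u) :
    u.length < l.length := by
  rw [e, List.length_append]
  have := List.length_pos_iff.2 hv
  omega

theorem isLinearMap_cmp {Y : Type*} [AddCommGroup Y] [Module ℝ Y] {Ψ : Y → List Z → W}
    (h : ∀ l, IsLinearMap ℝ fun y => Ψ y l) (l : List V) :
    IsLinearMap ℝ fun y => cmp F (Ψ y) l := by
  induction hn : l.length using Nat.strong_induction_on generalizing l Ψ with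
  | _ n ih =>
    subst hn
    by_cases hl : l = []
    · subst hl; simpa only [cmp] using h []
    · simp only [cmp_eq hl]
      exact isLinearMap_splNe fun v u hv e =>
        ih _ (length_lt_of_append hv e) (fun _ => h _) u rfl

theorem cmp_eq_zero_of_mem (hF : IsML F) {Ψ : List Z → W} (hΨ : IsML Ψ) {l : List V}
    (hl : (0 : V) ∈ l) : cmp F Ψ l = 0 := by
  induction hn : l.length using Nat.strong_induction_on generalizing l Ψ with
  | _ n ih =>
    subst hn
    rw [cmp_eq (List.ne_nil_of_mem hl)]
    refine splNe_eq_zero fun v u hv e => ?_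
    rw [e, List.mem_append] at hl
    rcases hl with h | h
    · rw [hF.zero_mem h]
      exact (isLinearMap_cmp (fun l => hΨ [] l) u).map_zero
    · exact ih _ (length_lt_of_append hv e) (hΨ.cons _) h rfl

/-- The entry created by an insertion lies in exactly one block, so inserting `A` and then cutting
into blocks amounts to cutting first and replacing `F` by `F ∘ Â` on one block. Thus the Leibniz sum
of `cmp` in the direction `F ∘ Â` is precomposition with Â. -/
theorem ins_cmp {A : List V → V} {Ψ : List Z → W} (hΨ : IsML Ψ) (l : List V) :
    ins .id A (cmp F Ψ) l = dcmp F (ins .id A F) Ψ l := by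
  induction hn : l.length using Nat.strong_induction_on generalizing l Ψ with
  | _ n ih =>
    subst hn
    have h1 : ins .id A (cmp F Ψ) l =
        ins .id A (splNe fun v u => cmp F (fun l => Ψ (F v :: l)) u) l :=
      -- A list that has received an insertion is nonempty, so the recursion for nonempty lists
      -- applies.
      ins_congr fun _ _ _ _ _ => cmp_eq (by simp)
    rw [h1, ins_splNe, ← splNe_add, dcmp_eq]
    refine splNe_congr fun v u hv e => ?_
    congr 1
    · exact (map_ins (f := fun z => cmp F (fun l => Ψ (z :: l)) u)
        (isLinearMap_cmp (fun l => hΨ [] l) u) F v).symm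
    · rw [LinearMap.id_coe, List.map_id]
      exact ih _ (length_lt_of_append hv e) (hΨ.cons _) u rfl

/-- The list function that is the identity on one-element lists and vanishes on all others. -/
def single : List V → V
  | [x] => x
  | _ => 0

theorem single_of_length_ne {l : List V} (h : l.length ≠ 1) : single l = 0 := by
  match l with
  | [] => rfl
  | [x] => exact absurd rfl h
  | _ :: _ :: _ => rfl

theorem isML_single : IsML (single : List V → V) := by
  intro l₁ l₂
  by_cases h : l₁ = [] ∧ l₂ = []
  · obtain ⟨rfl, rfl⟩ := h
    exact ⟨fun _ _ => rfl, fun _ _ => rfl⟩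
  · convert isLinearMap_zero with x
    refine single_of_length_ne fun hl => h ?_
    simp only [List.length_append, List.length_cons] at hl
    exact ⟨List.length_eq_zero_iff.1 (by omega), List.length_eq_zero_iff.1 (by omega)⟩

/-- Only the decomposition into one-element blocks survives. -/
theorem cmp_single {Ψ : List V → W} (hΨ : IsML Ψ) (l : List V) : cmp single Ψ l = Ψ l := by
  induction l generalizing Ψ with
  | nil => rw [cmp]
  | cons x w ih =>
    have h0 : ∀ v u, v ≠ [] → cmp single (fun l => Ψ (single (x :: v) :: l)) u = 0 := by
      intro v u hv
      rw [single_of_length_ne (l := x :: v) (by simpa using hv)]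
      exact (isLinearMap_cmp (fun l => hΨ [] l) u).map_zero
    rw [cmp_eq (by simp), splNe, spl_eq, splNe_eq_zero fun v u hv _ => h0 v u hv, add_zero]
    exact ih (hΨ.cons x)

theorem ins_single {σ : V →ₗ[ℝ] V} {g : List V → V} {l : List V} (hl : l ≠ []) :
    ins σ g single l = g l := by
  obtain ⟨x, w, rfl⟩ := List.exists_cons_of_ne_nil hl
  have h2 : ∀ w : List V, ins σ g (fun l => single (σ x :: l)) w = 0 := fun w =>
    ins_eq_zero fun l₁ l₂ l₃ _ _ => single_of_length_ne (by simp)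
  have h3 : ∀ (w : List V) (f : List V → V), spl (fun v u => single (f v :: u)) w = f w := by
    intro w
    induction w with
    | nil => intro f; rfl
    | cons y w ih =>
      intro f
      rw [spl, ih, single_of_length_ne (by simp), zero_add]
  rw [ins, h2, add_zero, splNe, h3]

end ListFunctions

/-! ### Transport along a path -/

section Transport

variable {V : Type*} [AddCommGroup V] [Module ℝ V] {W : Type*} [AddCommGroup W] [Module ℝ W]
  {Z : Type*} [AddCommGroup Z] [Module ℝ Z]

theorem WCont.spl {K : ℝ → List V → List V → W} {l : List V} (h : ∀ v u, WCont fun t => K t v u) :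
    WCont fun t => spl (K t) l := by
  induction l generalizing K with
  | nil => exact h [] []
  | cons x w ih => exact (h [] (x :: w)).add (ih fun v u => h (x :: v) u)

theorem WCont.splNe {K : ℝ → List V → List V → W} {l : List V}
    (h : ∀ v u, WCont fun t => K t v u) : WCont fun t => splNe (K t) l := by
  cases l with
  | nil => exact WCont.const 0
  | cons x w => exact WCont.spl fun v u => h (x :: v) u

theorem WDeriv.spl {K K' : ℝ → List V → List V → W} {l : List V}
    (h : ∀ v u, l = v ++ u → WDeriv (fun t => K t v u) fun t => K' t v u) :
    WDeriv (fun t => spl (K t) l) fun t => spl (K' t) l := by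
  induction l generalizing K K' with
  | nil => exact h [] [] rfl
  | cons x w ih =>
    exact (h [] (x :: w) rfl).add (ih fun v u e => h (x :: v) u (by rw [e]; rfl))

theorem WDeriv.splNe {K K' : ℝ → List V → List V → W} {l : List V}
    (h : ∀ v u, v ≠ [] → l = v ++ u → WDeriv (fun t => K t v u) fun t => K' t v u) :
    WDeriv (fun t => splNe (K t) l) fun t => splNe (K' t) l := by
  cases l with
  | nil => exact WDeriv.const 0
  | cons x w => exact WDeriv.spl fun v u e => h (x :: v) u (by simp) (by rw [e]; rfl)

theorem WCont.ins {σ : V →ₗ[ℝ] V} {g : ℝ → List V → V} {Φ : ℝ → List V → W}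
    (hΦ : ∀ t, IsML (Φ t)) (hg : ∀ l, WCont fun t => g t l) (h : ∀ l, WCont fun t => Φ t l)
    (l : List V) : WCont fun t => ins σ (g t) (Φ t) l := by
  induction l generalizing Φ with
  | nil => exact WCont.const 0
  | cons x w ih =>
    exact (WCont.splNe fun v u => WCont.apply (B := fun t => (hΦ t).head u) (fun x => h _) (hg v)).add
      (ih (fun t => (hΦ t).cons (σ x)) fun l => h _)

theorem WDeriv.ins {σ : V →ₗ[ℝ] V} {g g' : ℝ → List V → V} {Φ Φ' : ℝ → List V → W}
    (hΦ : ∀ t, IsML (Φ t)) (hΦ' : ∀ t, IsML (Φ' t))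
    (hg : ∀ l, WDeriv (fun t => g t l) fun t => g' t l)
    (h : ∀ l, WDeriv (fun t => Φ t l) fun t => Φ' t l) (l : List V) :
    WDeriv (fun t => ins σ (g t) (Φ t) l)
      fun t => ins σ (g t) (Φ' t) l + ins σ (g' t) (Φ t) l := by
  induction l generalizing Φ Φ' with
  | nil => simpa [AInfFamily.ins] using WDeriv.const (0 : W)
  | cons x w ih =>
    have h1 := WDeriv.splNe (l := x :: w) fun v u _ _ =>
      WDeriv.apply (B := fun t => (hΦ t).head u) (B' := fun t => (hΦ' t).head u)
        (fun x => h _) (hg v)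
    refine (h1.add (ih (fun t => (hΦ t).cons (σ x)) (fun t => (hΦ' t).cons (σ x))
      fun l => h _)).congr (fun t _ => rfl) fun t _ => ?_
    simp only [AInfFamily.ins, splNe_add, IsML.head_apply]
    abel

theorem isLinearMap_dcmp {Y : Type*} [AddCommGroup Y] [Module ℝ Y] {F F' : List V → Z}
    {Ψ : Y → List Z → W} (h : ∀ l, IsLinearMap ℝ fun y => Ψ y l) (l : List V) :
    IsLinearMap ℝ fun y => dcmp F F' (Ψ y) l := by
  induction hn : l.length using Nat.strong_induction_on generalizing l Ψ with
  | _ n ih =>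
    subst hn
    simp only [dcmp_eq (l := l)]
    exact isLinearMap_splNe fun v u hv e => isLinearMap_add (isLinearMap_cmp (fun _ => h _) u)
      (ih _ (length_lt_of_append hv e) (fun _ => h _) u rfl)

/-- Leibniz rule, by peeling off the first block: the remaining sum is a linear operator applied to
the output of that block, and `WDeriv.apply` differentiates both. -/
theorem WDeriv.cmp {F F' : ℝ → List V → Z} {Ψ : List Z → W} (hΨ : IsML Ψ)
    (hF : ∀ l, WDeriv (fun t => F t l) fun t => F' t l) (l : List V) :
    WDeriv (fun t => cmp (F t) Ψ l) fun t => dcmp (F t) (F' t) Ψ l := by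
  induction hn : l.length using Nat.strong_induction_on generalizing l Ψ with
  | _ n ih =>
    subst hn
    by_cases hl : l = []
    · subst hl
      simpa only [AInfFamily.cmp, dcmp] using WDeriv.const (Ψ [])
    · simp only [cmp_eq hl, dcmp_eq (l := l)]
      refine WDeriv.splNe fun v u hv e => ?_
      have h1 := WDeriv.apply
        (B := fun t => (isLinearMap_cmp (F := F t) (fun l => hΨ [] l) u).mk')
        (B' := fun t => (isLinearMap_dcmp (F := F t) (F' := F' t) (fun l => hΨ [] l) u).mk')
        (fun z => ih _ (length_lt_of_append hv e) (hΨ.cons z) u rfl) (hF v)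
      exact h1.congr (fun t _ => rfl) fun t _ => add_comm _ _

theorem isLinearMap_wInt {K : Z → ℝ → V} (h : ∀ s, IsLinearMap ℝ fun z => K z s)
    (hc : ∀ z, WCont (K z)) {p q : ℝ} (hp : p ∈ Set.Icc (0 : ℝ) 1) (hq : q ∈ Set.Icc (0 : ℝ) 1) :
    IsLinearMap ℝ fun z => wInt p q (K z) := by
  constructor
  · intro x y
    refine dual_ext fun φ => ?_
    rw [map_add, (hc _).wInt_spec hp hq, (hc _).wInt_spec hp hq, (hc _).wInt_spec hp hq,
      ← intervalIntegral.integral_add ((hc x).intervalIntegrable hp hq φ)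
        ((hc y).intervalIntegrable hp hq φ)]
    simp only [(h _).map_add, map_add]
  · intro c x
    refine dual_ext fun φ => ?_
    rw [map_smul, (hc _).wInt_spec hp hq, (hc _).wInt_spec hp hq, smul_eq_mul,
      ← intervalIntegral.integral_const_mul]
    simp only [(h _).map_smul, map_smul, smul_eq_mul]

/-- The retraction of `ℝ` onto `[0, 1]`. -/
def clamp (p : ℝ) : ℝ := Set.projIcc (0 : ℝ) 1 zero_le_one p

theorem clamp_mem (p : ℝ) : clamp p ∈ Set.Icc (0 : ℝ) 1 := (Set.projIcc _ _ _ p).2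

theorem clamp_of_mem {p : ℝ} (hp : p ∈ Set.Icc (0 : ℝ) 1) : clamp p = p := by
  rw [clamp, Set.projIcc_of_mem _ hp]

/-- The integral over the simplex from `p` to `q` of the sum of all trees with `k` levels. -/
def treeInt (A : ℝ → List V → V) (q : ℝ) : ℕ → ℝ → List V → V
  | 0, _, l => single l
  | k + 1, p, l => wInt (clamp p) q fun s => ins .id (A s) (treeInt A q k s) l

/-- The alternating sum of all tree integrals. -/
def transport (A : ℝ → List V → V) (q p : ℝ) (l : List V) : V :=
  ∑ k ∈ Finset.range l.length, (-1 : ℝ) ^ k • treeInt A q k p l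

/-- Multilinear maps of arbitrary arity, depending continuously on a parameter in `[0, 1]`, without
unary component. -/
structure IsConnection (A : ℝ → List V → V) : Prop where
  isML : ∀ t, IsML (A t)
  wCont : ∀ l, WCont fun t => A t l
  unary : ∀ t x, A t [x] = 0

variable {A : ℝ → List V → V} {q : ℝ}

/-- The two properties need each other: linearity of the integral requires weakly continuous
integrands, and continuity of the next integrand uses multilinearity of the previous level. Clamping
the lower limit makes multilinearity hold for every real `p`. -/
theorem treeInt_spec (hA : IsConnection A) (hq : q ∈ Set.Icc (0 : ℝ) 1) (k : ℕ) :
    (∀ p, IsML (treeInt A q k p)) ∧ ∀ l, WCont fun p => treeInt A q k p l := by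
  induction k with
  | zero => exact ⟨fun p => isML_single, fun l => WCont.const _⟩
  | succ k ih =>
    have h1 : ∀ l, WCont fun s => ins .id (A s) (treeInt A q k s) l := WCont.ins ih.1 hA.wCont ih.2
    refine ⟨fun p l₁ l₂ => ?_, fun l => ?_⟩
    · exact isLinearMap_wInt (K := fun z s => ins .id (A s) (treeInt A q k s) (l₁ ++ z :: l₂))
        (fun s => (hA.isML s).ins (ih.1 s) l₁ l₂) (fun z => h1 _) (clamp_mem p) hq
    · refine ((h1 l).wDeriv_wInt hq).wCont.congr fun p hp => ?_
      rw [treeInt, clamp_of_mem hp]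

theorem treeInt_isML (hA : IsConnection A) (hq : q ∈ Set.Icc (0 : ℝ) 1) (k : ℕ) (p : ℝ) :
    IsML (treeInt A q k p) := (treeInt_spec hA hq k).1 p

theorem treeInt_wCont_ins (hA : IsConnection A) (hq : q ∈ Set.Icc (0 : ℝ) 1) (k : ℕ) (l : List V) :
    WCont fun s => ins .id (A s) (treeInt A q k s) l :=
  WCont.ins (treeInt_spec hA hq k).1 hA.wCont (treeInt_spec hA hq k).2 l

theorem treeInt_wDeriv (hA : IsConnection A) (hq : q ∈ Set.Icc (0 : ℝ) 1) (k : ℕ) (l : List V) :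
    WDeriv (fun p => treeInt A q (k + 1) p l) fun p => -ins .id (A p) (treeInt A q k p) l :=
  ((treeInt_wCont_ins hA hq k l).wDeriv_wInt hq).congr
    (fun p hp => by rw [treeInt, clamp_of_mem hp]) fun _ _ => rfl

/-- As `A` has no unary component, insertions of `A` into a list strictly shorten it. -/
theorem ins_eq_zero_of_length (hA : IsConnection A) {t : ℝ} {Φ : List V → W} {l : List V}
    (h0 : ∀ l, (0 : V) ∈ l → Φ l = 0) (h : ∀ l', l' ≠ [] → l'.length < l.length → Φ l' = 0) :
    ins .id (A t) Φ l = 0 := by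
  refine ins_eq_zero fun l₁ l₂ l₃ hl₂ e => ?_
  rcases l₂ with - | ⟨x, - | ⟨y, l₂⟩⟩
  · exact absurd rfl hl₂
  · rw [hA.unary]
    exact h0 _ (by simp)
  · refine h _ (by simp) ?_
    rw [e]
    simp

/-- Each level strictly shortens the list and one entry must remain, so k levels need at least k + 1
leaves. -/
theorem treeInt_eq_zero (hA : IsConnection A) (hq : q ∈ Set.Icc (0 : ℝ) 1) (k : ℕ) (p : ℝ)
    (l : List V) (hl : l.length ≤ k) : treeInt A q k p l = 0 := by
  induction k generalizing p l with
  | zero => exact single_of_length_ne (by omega)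
  | succ k ih =>
    have h0 : (fun s => ins .id (A s) (treeInt A q k s) l) = fun _ => 0 := by
      funext s
      exact ins_eq_zero_of_length hA (fun l h => (treeInt_isML hA hq k s).zero_mem h)
        fun l' _ h => ih s l' (by omega)
    rw [treeInt, h0]
    exact dual_ext fun φ => by
      rw [(WCont.const (0 : V)).wInt_spec (clamp_mem p) hq]; simp

theorem transport_eq (hA : IsConnection A) (hq : q ∈ Set.Icc (0 : ℝ) 1) {N : ℕ} {p : ℝ}
    {l : List V} (h : l.length ≤ N) :
    transport A q p l = ∑ k ∈ Finset.range N, (-1 : ℝ) ^ k • treeInt A q k p l := by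
  refine Finset.sum_subset (Finset.range_mono h) fun k _ hk => ?_
  rw [treeInt_eq_zero hA hq k p l (by simpa using hk), smul_zero]

theorem transport_isML (hA : IsConnection A) (hq : q ∈ Set.Icc (0 : ℝ) 1) (p : ℝ) :
    IsML (transport A q p) := by
  intro l₁ l₂
  -- The range in `transport` depends on the list; a range independent of `x` is needed to speak of
  -- linearity in `x`.
  have : ∀ x, transport A q p (l₁ ++ x :: l₂) = ∑ k ∈ Finset.range (l₁.length + l₂.length + 1),
      (-1 : ℝ) ^ k • treeInt A q k p (l₁ ++ x :: l₂) :=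
    fun x => transport_eq hA hq (by simp; omega)
  simp only [this]
  exact isLinearMap_sum _ fun k _ => isLinearMap_smul _ (treeInt_isML hA hq k p l₁ l₂)

/-- Integrals over a degenerate simplex vanish, which leaves the identity tree. -/
theorem transport_self (hq : q ∈ Set.Icc (0 : ℝ) 1) (l : List V) :
    transport A q q l = single l := by
  have h0 : ∀ k, treeInt A q (k + 1) q l = 0 := fun k => by
    rw [treeInt, clamp_of_mem hq, wInt_self]
  rcases Nat.eq_zero_or_pos l.length with h | h
  · rw [transport, h, single_of_length_ne (by omega)]
    rfl
  · rw [transport, ← Nat.sub_add_cancel h, Finset.sum_range_succ']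
    simp only [h0, smul_zero, Finset.sum_const_zero, pow_zero, one_smul, zero_add]
    rfl

/-- Differentiating in the lower limit removes the level next to the leaves and produces a minus
sign, which the alternating sign of the sum absorbs. -/
theorem transport_wDeriv (hA : IsConnection A) (hq : q ∈ Set.Icc (0 : ℝ) 1) (l : List V) :
    WDeriv (fun p => transport A q p l) fun p => ins .id (A p) (transport A q p) l := by
  have h1 : ∀ p, transport A q p l = single l +
      ∑ k ∈ Finset.range l.length, (-1 : ℝ) ^ (k + 1) • treeInt A q (k + 1) p l := fun p => by
    rw [transport_eq hA hq (Nat.le_succ _), Finset.sum_range_succ', add_comm]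
    simp [treeInt]
  have h2 : ∀ p, ins .id (A p) (transport A q p) l =
      ∑ k ∈ Finset.range l.length, (-1 : ℝ) ^ k • ins .id (A p) (treeInt A q k p) l := fun p => by
    have h3 : ∀ k, (-1 : ℝ) ^ k • ins .id (A p) (treeInt A q k p) l =
        ins .id (A p) (fun l => (-1 : ℝ) ^ k • treeInt A q k p l) l := fun k =>
      map_ins (f := fun z : V => (-1 : ℝ) ^ k • z) (isLinearMap_smul _ LinearMap.id.isLinear) _ _
    have h4 : ∀ (s : Finset ℕ), ∑ k ∈ s, ins .id (A p) (fun l => (-1 : ℝ) ^ k • treeInt A q k p l) l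
        = ins .id (A p) (fun l => ∑ k ∈ s, (-1 : ℝ) ^ k • treeInt A q k p l) l := fun s => by
      induction s using Finset.induction_on with
      | empty => simp [ins_zero]
      | insert k s hk ih => simp only [Finset.sum_insert hk, ih, ins_add]
    simp only [h3, h4]
    -- After an insertion the list is no longer than `l`, so truncating at `l.length` still captures
    -- the whole transport.
    refine ins_congr fun l₁ l₂ l₃ hl₂ e => transport_eq hA hq ?_
    have := List.length_pos_iff.2 hl₂
    rw [e]
    simp
    omega
  have h5 := (WDeriv.const (single l)).add (WDeriv.sum (s := Finset.range l.length) fun k _ =>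
    (treeInt_wDeriv hA hq k l).map ((-1 : ℝ) ^ (k + 1) • LinearMap.id))
  refine h5.congr (fun p _ => h1 p) fun p _ => ?_
  rw [h2, zero_add]
  simp [pow_succ]

/-- The defect of the morphism equation solves D' = D ∘ Â. The induction on length makes the right
side zero, so D equals its value at `q`. The induction hypothesis must hold at all times in [0, 1],
hence the generalization over `p`. -/
theorem transport_cmp (hA : IsConnection A) (hq : q ∈ Set.Icc (0 : ℝ) 1) {ε : V →ₗ[ℝ] V}
    (hε : ∀ t ∈ Set.Icc (0 : ℝ) 1, ∀ l, A t (l.map ε) = ε (A t l)) {μ : ℝ → List V → V} (hμ : ∀ t, IsML (μ t))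
    (h : ∀ l, WDeriv (fun t => μ t l) fun t => ins .id (A t) (μ t) l - ins ε (μ t) (A t) l)
    {p : ℝ} (hp : p ∈ Set.Icc (0 : ℝ) 1) {l : List V} (hl : l ≠ []) :
    cmp (transport A q p) (μ q) l = ins ε (μ p) (transport A q p) l := by
  have hF := fun t => transport_isML hA hq t
  induction hn : l.length using Nat.strong_induction_on generalizing l p with
  | _ n ih =>
    subst hn
    have h1 := WDeriv.cmp (hμ q) (transport_wDeriv hA hq) l
    have h2 := WDeriv.ins (σ := ε) (g := μ) hF (fun t => (hA.isML t).ins (hF t)) h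
      (transport_wDeriv hA hq) l
    have h3 := (h1.sub h2).eq_const (fun t ht => ?_) hp hq
    · rw [← sub_eq_zero, h3]
      have : transport A q q = single := funext (transport_self hq)
      rw [this, cmp_single (hμ q), ins_single hl, sub_self]
    -- Both derivatives become precompositions with Â, so their difference is Â applied to the
    -- defect.
    · rw [ins_comp_map (hε t ht) (μ t) (hF t), ← ins_cmp (hμ q)]
      have h4 : ∀ l, ins .id (A t) (cmp (transport A q t) (μ q)) l =
          ins .id (A t) (fun l => cmp (transport A q t) (μ q) l -
            ins ε (μ t) (transport A q t) l) l +
          ins .id (A t) (ins ε (μ t) (transport A q t)) l := fun l => by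
        rw [← ins_add]; simp
      rw [h4, add_sub_cancel_right]
      refine ins_eq_zero_of_length hA (fun l h0 => ?_) fun l' hl' hlt => ?_
      · rw [cmp_eq_zero_of_mem (hF t) (hμ q) h0, ((hμ t).ins (hF t)).zero_mem h0, sub_self]
      · rw [ih _ hlt ht hl' rfl, sub_self]

end Transport

/-! ### Lists and sequences -/

section Sequences

variable {V : Type*} [AddCommGroup V] [Module ℝ V] {W : Type*} [AddCommGroup W] [Module ℝ W]
  {Z : Type*} [AddCommGroup Z] [Module ℝ Z]

/-- The list function given by a family of multilinear maps. -/
def evL (f : ∀ n, MultilinearMap ℝ (fun _ : Fin n => V) W) (l : List V) : W := f l.length l.get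

theorem evL_eq (f : ∀ n, MultilinearMap ℝ (fun _ : Fin n => V) W) {l : List V} {n : ℕ}
    (h : l.length = n) (b : Fin n → V) (hb : ∀ i (hi : i < l.length), l[i] = b ⟨i, h ▸ hi⟩) :
    evL f l = f n b := by
  subst h
  exact congrArg _ (funext fun i : Fin l.length => hb i i.2)

/-- The list of the first `n` terms of a sequence. -/
def seqL (n : ℕ) (a : ℕ → V) : List V := (List.range n).map a

@[simp] theorem length_seqL (n : ℕ) (a : ℕ → V) : (seqL n a).length = n := by simp [seqL]

@[simp] theorem getElem_seqL (n : ℕ) (a : ℕ → V) (i : ℕ) (h : i < (seqL n a).length) :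
    (seqL n a)[i] = a i := by simp [seqL]

theorem evL_seqL (f : ∀ n, MultilinearMap ℝ (fun _ : Fin n => V) W) (n : ℕ) (a : ℕ → V) :
    evL f (seqL n a) = f n fun i => a i :=
  evL_eq f (by simp) _ fun i hi => by simp

theorem seqL_zero (a : ℕ → V) : seqL 0 a = [] := rfl

theorem seqL_succ (n : ℕ) (a : ℕ → V) : seqL (n + 1) a = a 0 :: seqL n fun i => a (i + 1) := by
  simp [seqL, List.range_succ_eq_map]

theorem seqL_succ_last (n : ℕ) (a : ℕ → V) : seqL (n + 1) a = seqL n a ++ [a n] := by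
  simp [seqL, List.range_succ]

theorem take_seqL {j n : ℕ} (h : j ≤ n) (a : ℕ → V) : (seqL n a).take j = seqL j a :=
  List.ext_getElem (by simp [h]) fun i _ _ => by simp

theorem drop_seqL (j n : ℕ) (a : ℕ → V) :
    (seqL n a).drop j = seqL (n - j) fun i => a (j + i) :=
  List.ext_getElem (by simp) fun i _ _ => by simp

theorem seqL_insertAt {n j r : ℕ} (h : j + r ≤ n) (hr : 1 ≤ r) (a : ℕ → V) (x : V) :
    seqL (n - r + 1) (insertAt a j r x) =
      seqL j a ++ x :: seqL (n - r - j) fun i => a (j + r + i) := by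
  refine List.ext_getElem (by simp; omega) fun i h1 h2 => ?_
  rw [getElem_seqL, List.getElem_append]
  simp only [length_seqL, getElem_seqL, List.getElem_cons, insertAt]
  split_ifs with h3 h4 h5 h5
  · rfl
  · rfl
  · omega
  · omega
  · congr 1; omega

theorem evL_isML (f : ∀ n, MultilinearMap ℝ (fun _ : Fin n => V) W) : IsML (evL f) := by
  intro l₁ l₂
  have hlt : l₁.length < l₁.length + (l₂.length + 1) := by omega
  have h : ∀ x, evL f (l₁ ++ x :: l₂) = f (l₁.length + (l₂.length + 1))
      (Function.update (fun i => (l₁ ++ 0 :: l₂)[i]'(by simp)) ⟨l₁.length, hlt⟩ x) := by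
    intro x
    refine evL_eq f (by simp) _ fun i hi => ?_
    simp only [Function.update_apply, Fin.mk.injEq, Fin.getElem_fin]
    split_ifs with h1
    · subst h1; simp
    · simp only [List.getElem_append, List.getElem_cons]
      split_ifs with h2 h3
      · rfl
      · omega
      · rfl
  simp only [h]
  exact ⟨fun x y => MultilinearMap.map_update_add _ _ _ _ _,
    fun c x => MultilinearMap.map_update_smul _ _ _ _ _⟩

theorem ofFn_update {n : ℕ} (a : Fin n → V) (i : Fin n) (x : V) :
    List.ofFn (Function.update a i x) =
      (List.ofFn a).take i ++ x :: (List.ofFn a).drop (i + 1) := by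
  refine List.ext_getElem (by simp; omega) fun k h1 h2 => ?_
  simp only [List.getElem_ofFn, List.getElem_append, List.getElem_cons, List.length_take,
    List.length_ofFn, Function.update_apply, Fin.ext_iff, List.getElem_take, List.getElem_drop]
  have := i.2
  split_ifs with h3 h4 h5 h6 <;> first | rfl | omega | skip
  congr 2; omega

/-- The multilinear maps given by a multilinear list function. -/
def IsML.toMultilinearMap {Φ : List V → W} (h : IsML Φ) (n : ℕ) :
    MultilinearMap ℝ (fun _ : Fin n => V) W where
  toFun a := Φ (List.ofFn a)
  map_update_add' {inst} a i x y := by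
    rw [Subsingleton.elim inst (instDecidableEqFin n)]
    simp only [ofFn_update]
    exact (h _ _).map_add x y
  map_update_smul' {inst} a i c x := by
    rw [Subsingleton.elim inst (instDecidableEqFin n)]
    simp only [ofFn_update]
    exact (h _ _).map_smul c x

theorem IsML.toMultilinearMap_seq {Φ : List V → W} (h : IsML Φ) (n : ℕ) (a : ℕ → V) :
    h.toMultilinearMap n (fun i => a i) = Φ (seqL n a) :=
  congrArg Φ (List.ext_getElem (by simp) fun i _ _ => by simp)

theorem IsML.evL_toMultilinearMap {Φ : List V → W} (h : IsML Φ) : evL h.toMultilinearMap = Φ :=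
  funext fun l => congrArg Φ (List.ofFn_get l)

theorem sum_Icc_one_eq (n : ℕ) (f : ℕ → W) :
    ∑ m ∈ Finset.Icc 1 n, f m = ∑ m ∈ Finset.range n, f (m + 1) := by
  rw [Finset.range_eq_Ico, Finset.sum_Ico_add' f 0 n 1]
  rfl

/-- Insertions are indexed by block length `m` and starting position `j`. The terms with `j = 0` are
the first summand in the recursion for `ins`; the others shift to the tail. -/
theorem ins_seqL (σ : V →ₗ[ℝ] V) (g : List V → V) (Φ : List V → W) (n : ℕ) (a : ℕ → V) :
    ins σ g Φ (seqL n a) = ∑ m ∈ Finset.Icc 1 n, ∑ j ∈ Finset.range (n - m + 1),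
      Φ ((seqL j a).map σ ++ g (seqL m fun i => a (j + i)) ::
        seqL (n - m - j) fun i => a (j + m + i)) := by
  rw [sum_Icc_one_eq]
  induction n generalizing Φ a with
  | zero => simp [seqL_zero, ins]
  | succ n ih =>
    rw [seqL_succ, ins, ih, splNe, spl_eq_sum, Finset.sum_congr rfl
      (fun m hm => Finset.sum_range_succ' _ (n + 1 - (m + 1))), Finset.sum_add_distrib, add_comm]
    rw [Finset.sum_range_succ _ n]
    congr 1
    · simp only [Nat.sub_self, Finset.range_zero, Finset.sum_empty, add_zero]
      refine Finset.sum_congr rfl fun m hm => ?_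
      have : n + 1 - (m + 1) = n - (m + 1) + 1 := by
        have := Finset.mem_range.1 hm; omega
      rw [this]
      refine Finset.sum_congr rfl fun j hj => ?_
      rw [seqL_succ j a, show n - (m + 1) + 1 - (j + 1) = n - (m + 1) - j by omega]
      simp only [List.map_cons, List.cons_append, add_right_comm]
    · rw [length_seqL]
      refine Finset.sum_congr rfl fun m hm => ?_
      have : m ≤ n := by have := Finset.mem_range.1 hm; omega
      rw [take_seqL this, drop_seqL]
      simp only [zero_add, seqL_zero, List.map_nil, List.nil_append]
      rw [seqL_succ m a, show n + 1 - (m + 1) - 0 = n - m by omega]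
      congr 3
      ext i
      congr 1
      omega

/-- Scaling a homogeneous vector by the sign of its reduced degree. -/
def IsSign (𝒱 : ℤ → Submodule ℝ V) (ε : V →ₗ[ℝ] V) : Prop :=
  ∀ i, ∀ x ∈ 𝒱 i, ε x = (-1 : ℝ) ^ (i - 1) • x

/-- Pulling ε out of the first `j` homogeneous entries yields exactly the Koszul sign of an inserted
operation of reduced degree 1. -/
theorem IsML.map_sign {𝒱 : ℤ → Submodule ℝ V} {ε : V →ₗ[ℝ] V} (hε : IsSign 𝒱 ε) {Φ : List V → W}
    (hΦ : IsML Φ) {deg : ℕ → ℤ} {a : ℕ → V} (ha : ∀ i, a i ∈ 𝒱 (deg i)) (j : ℕ) (l : List V) :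
    Φ ((seqL j a).map ε ++ l) = (-1 : ℝ) ^ maltese deg j • Φ (seqL j a ++ l) := by
  induction j generalizing l with
  | zero => simp [seqL_zero, maltese]
  | succ j ih =>
    rw [seqL_succ_last, List.map_append, List.append_assoc, ih, List.map_singleton, hε _ _ (ha j),
      List.singleton_append, (hΦ _ l).map_smul, smul_smul, ← zpow_add₀ (by norm_num), maltese,
      maltese, Finset.sum_range_succ, List.append_assoc, List.singleton_append]

theorem sum_gComp_zero (f : ∀ n, MultilinearMap ℝ (fun _ : Fin n => V) W)
    (g : ∀ n, MultilinearMap ℝ (fun _ : Fin n => V) V) (n : ℕ) (deg : ℕ → ℤ) (a : ℕ → V) :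
    ∑ m ∈ Finset.Icc 1 n, gComp (f (n - m + 1)) (g m) 0 deg a =
      ins .id (evL g) (evL f) (seqL n a) := by
  rw [ins_seqL]
  refine Finset.sum_congr rfl fun m hm => Finset.sum_congr rfl fun j hj => ?_
  rw [Finset.mem_Icc] at hm
  rw [Finset.mem_range] at hj
  rw [LinearMap.id_coe, List.map_id, ← seqL_insertAt (by omega) hm.1, evL_seqL, evL_seqL]
  simp

theorem sum_gComp_one {𝒱 : ℤ → Submodule ℝ V} {ε : V →ₗ[ℝ] V} (hε : IsSign 𝒱 ε)
    (f : ∀ n, MultilinearMap ℝ (fun _ : Fin n => V) W)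
    (g : ∀ n, MultilinearMap ℝ (fun _ : Fin n => V) V) (n : ℕ) {deg : ℕ → ℤ} {a : ℕ → V}
    (ha : ∀ i, a i ∈ 𝒱 (deg i)) :
    ∑ m ∈ Finset.Icc 1 n, gComp (f (n - m + 1)) (g m) 1 deg a =
      ins ε (evL g) (evL f) (seqL n a) := by
  rw [ins_seqL]
  refine Finset.sum_congr rfl fun m hm => Finset.sum_congr rfl fun j hj => ?_
  rw [Finset.mem_Icc] at hm
  rw [Finset.mem_range] at hj
  rw [(evL_isML f).map_sign hε ha, ← seqL_insertAt (by omega) hm.1, evL_seqL, evL_seqL, one_mul]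

theorem gComp_eq_zero {k r : ℕ} (f : MultilinearMap ℝ (fun _ : Fin k => V) W) (e : ℤ)
    (deg : ℕ → ℤ) (a : ℕ → V) : gComp f (0 : MultilinearMap ℝ (fun _ : Fin r => V) V) e deg a = 0 := by
  refine Finset.sum_eq_zero fun j hj => ?_
  rw [f.map_coord_zero ⟨j, Finset.mem_range.1 hj⟩ (by simp [insertAt]), smul_zero]

/-- The two extreme terms drop out: arity 0 inside because `g 0 = 0`, and arity 0 outside because
there is no slot to compose in. -/
theorem sum_antidiagonal_gComp (f : ∀ n, MultilinearMap ℝ (fun _ : Fin n => V) W)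
    (g : ∀ n, MultilinearMap ℝ (fun _ : Fin n => V) V) (hg : g 0 = 0) (n : ℕ) (e : ℤ) (deg : ℕ → ℤ)
    (a : ℕ → V) :
    ∑ kr ∈ Finset.HasAntidiagonal.antidiagonal (n + 1), gComp (f kr.1) (g kr.2) e deg a =
      ∑ m ∈ Finset.Icc 1 n, gComp (f (n - m + 1)) (g m) e deg a := by
  rw [← Finset.Nat.sum_antidiagonal_swap, Finset.Nat.sum_antidiagonal_eq_sum_range_succ_mk,
    Finset.sum_range_succ, Finset.sum_range_succ', sum_Icc_one_eq]
  simp only [Prod.fst_swap, Prod.snd_swap, hg, gComp_eq_zero, add_zero]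
  rw [show gComp (f (n + 1 - (n + 1))) (g (n + 1)) e deg a = 0 by
    rw [Nat.sub_self]; exact Finset.sum_empty, add_zero]
  refine Finset.sum_congr rfl fun m hm => ?_
  rw [show n + 1 - (m + 1) = n - (m + 1) + 1 by have := Finset.mem_range.1 hm; omega]

theorem sum_composition_succ (n : ℕ) (f : List ℕ → W) :
    ∑ c : Composition (n + 1), f c.blocks =
      ∑ i : Fin (n + 1), ∑ c : Composition (n - i), f ((i + 1) :: c.blocks) := by
  refine Eq.trans (Eq.symm ?_) (Fintype.sum_sigma
    fun x : Σ i : Fin (n + 1), Composition (n - i) => f ((x.1 + 1) :: x.2.blocks))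
  refine Fintype.sum_bijective (fun x => (⟨(x.1 + 1) :: x.2.blocks, fun h => ?_, ?_⟩ :
    Composition (n + 1))) ⟨?_, ?_⟩ _ _ fun x => rfl
  · rcases List.mem_cons.1 h with rfl | h
    · omega
    · exact x.2.blocks_pos h
  · rw [List.sum_cons, x.2.blocks_sum]
    omega
  · rintro ⟨i, c⟩ ⟨i', c'⟩ h
    simp only [Composition.mk.injEq, List.cons.injEq, add_left_inj, Fin.val_inj] at h
    obtain ⟨rfl, h⟩ := h
    rw [Composition.ext h]
  · rintro ⟨bl, hpos, hsum⟩
    cases bl with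
    | nil => simp at hsum
    | cons k bl =>
      have hk := hpos List.mem_cons_self
      rw [List.sum_cons] at hsum
      refine ⟨⟨⟨k - 1, by omega⟩, ⟨bl, fun h => hpos (List.mem_cons_of_mem _ h), ?_⟩⟩, ?_⟩
      · change bl.sum = n - (k - 1)
        omega
      · ext1
        change (k - 1 + 1) :: bl = k :: bl
        rw [Nat.sub_add_cancel hk]

theorem cmp_eq_sum (F : List V → Z) (Ψ : List Z → W) (l : List V) :
    cmp F Ψ l = ∑ c : Composition l.length, Ψ ((l.splitWrtComposition c).map F) := by
  -- The total is decoupled from the list so that the induction can change both without casting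
  -- compositions.
  suffices ∀ n, n = l.length → cmp F Ψ l = ∑ c : Composition n,
      Ψ ((l.splitWrtCompositionAux c.blocks).map F) from this _ rfl
  intro n hn
  induction n using Nat.strong_induction_on generalizing l Ψ with
  | _ n ih =>
    cases l with
    | nil =>
      subst hn
      have : ∀ c : Composition ([] : List V).length, c.blocks = [] := fun c => c.blocks_eq_nil.2 rfl
      simp [cmp, this, List.splitWrtCompositionAux, composition_card]
    | cons x w =>
      obtain rfl : n = w.length + 1 := hn
      rw [cmp, sum_composition_succ w.length
        fun bl => Ψ (((x :: w).splitWrtCompositionAux bl).map F)]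
      refine Finset.sum_congr rfl fun i _ => ?_
      rw [ih (w.length - i) (by omega) _ _ (by simp)]
      refine Finset.sum_congr rfl fun c _ => ?_
      rw [List.splitWrtCompositionAux_cons]
      rfl

theorem cmp_evL (f : ∀ n, MultilinearMap ℝ (fun _ : Fin n => V) Z)
    (g : ∀ n, MultilinearMap ℝ (fun _ : Fin n => Z) W) (n : ℕ) (a : ℕ → V) :
    cmp (evL f) (evL g) (seqL n a) = ∑ c : Composition n, g c.length
      (fun i => f (c.blocksFun i) (fun l => a (c.embedding i l))) := by
  obtain ⟨m, hm⟩ : ∃ m, m = (seqL n a).length := ⟨_, rfl⟩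
  have hmn : m = n := by simpa using hm
  rw [cmp_eq_sum, ← hm]
  subst hmn
  refine Finset.sum_congr rfl fun c _ => ?_
  refine evL_eq g (by simp) _ fun i hi => ?_
  rw [List.getElem_map, List.getElem_splitWrtComposition]
  have hi' : i < c.length := by simpa using hi
  refine evL_eq f ?_ _ fun k hk => ?_
  · rw [List.length_drop, List.length_take, length_seqL, min_eq_left (c.sizeUpTo_le _),
      c.sizeUpTo_succ hi', add_tsub_cancel_left]
    rfl
  · simp [Composition.coe_embedding]

/-! ### Homogeneous list functions -/

/-- `Φ` raises the total reduced degree of the entries of a list by `e - 1`, as an element of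
`V`. -/
def IsHom (𝒱 : ℤ → Submodule ℝ V) (Φ : List V → V) (e : ℤ) : Prop :=
  ∀ L : List (ℤ × V), (∀ x ∈ L, x.2 ∈ 𝒱 x.1) →
    Φ (L.map Prod.snd) ∈ 𝒱 ((L.map fun x => x.1 - 1).sum + e)

theorem spl_mem {S : Submodule ℝ W} {K : List V → List V → W} {l : List V}
    (h : ∀ v u, l = v ++ u → K v u ∈ S) : spl K l ∈ S := by
  induction l generalizing K with
  | nil => exact h [] [] rfl
  | cons x w ih =>
    exact S.add_mem (h [] _ rfl) (ih fun v u e => h (x :: v) u (by rw [e]; rfl))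

theorem ins_mem {σ : V →ₗ[ℝ] V} {g : List V → V} {S : Submodule ℝ W} {Φ : List V → W} {l : List V}
    (h : ∀ l₁ l₂ l₃, l = l₁ ++ l₂ ++ l₃ → Φ (l₁.map σ ++ g l₂ :: l₃) ∈ S) : ins σ g Φ l ∈ S := by
  induction l generalizing Φ with
  | nil => exact S.zero_mem
  | cons x w ih =>
    refine S.add_mem (spl_mem fun v u e => h [] (x :: v) u (by rw [e]; rfl)) (ih ?_)
    exact fun l₁ l₂ l₃ e => h (x :: l₁) l₂ l₃ (by rw [e]; rfl)

variable {𝒱 : ℤ → Submodule ℝ V}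

/-- The inserted entry has the total reduced degree of the block it replaces, so the reduced degree
of the list is unchanged. -/
theorem IsHom.ins {g Φ : List V → V} {e : ℤ} (hg : IsHom 𝒱 g 1) (hΦ : IsHom 𝒱 Φ e) :
    IsHom 𝒱 (ins .id g Φ) e := by
  intro L hL
  refine ins_mem fun l₁ l₂ l₃ h => ?_
  obtain ⟨L₁₂, L₃, rfl, h₁₂, rfl⟩ := List.map_eq_append_iff.1 h
  obtain ⟨L₁, L₂, rfl, rfl, rfl⟩ := List.map_eq_append_iff.1 h₁₂
  have h2 := hg L₂ fun x hx => hL x (by simp [hx])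
  have h3 := hΦ (L₁ ++ ((L₂.map fun x => x.1 - 1).sum + 1, g (L₂.map Prod.snd)) :: L₃) fun x hx => by
    rcases List.mem_append.1 hx with h | h
    · exact hL x (by simp [h])
    · rcases List.mem_cons.1 h with rfl | h
      · exact h2
      · exact hL x (by simp [h])
  convert h3 using 2
  · simp
  · simp

theorem isHom_single : IsHom 𝒱 (single : List V → V) 1 := by
  intro L hL
  match L with
  | [] => exact Submodule.zero_mem _
  | [x] =>
    have := hL x (by simp)
    simpa [single] using this
  | _ :: _ :: _ => exact Submodule.zero_mem _

theorem transport_isHom {A : ℝ → List V → V} (hA : IsConnection A)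
    {q : ℝ} (hq : q ∈ Set.Icc (0 : ℝ) 1) (hh : ∀ t ∈ Set.Icc (0 : ℝ) 1, IsHom 𝒱 (A t) 1) (p : ℝ) :
    IsHom 𝒱 (transport A q p) 1 := by
  have h1 : ∀ k p, IsHom 𝒱 (treeInt A q k p) 1 := by
    intro k
    induction k with
    | zero => exact fun p => isHom_single
    | succ k ih =>
      exact fun p L hL => (treeInt_wCont_ins hA hq k _).wInt_mem (clamp_mem p) hq
        fun t ht => (hh t ht).ins (ih t) L hL
  exact fun L hL => Submodule.sum_mem _ fun k _ => Submodule.smul_mem _ _ (h1 k p L hL)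

/-- Passing from degrees to reduced degrees subtracts 1 per input, which absorbs the `-n` in the
degree of the n-ary map. -/
theorem evL_isHom {f : ∀ n, MultilinearMap ℝ (fun _ : Fin n => V) V} {e : ℤ}
    (hf : ∀ n : ℕ, IsHomogeneous 𝒱 𝒱 (f n) (e - n)) : IsHom 𝒱 (evL f) e := by
  intro L hL
  have h1 := hf L.length (fun i => (L.get i).1) (fun i => (L.get i).2) fun i => hL _ (L.get_mem i)
  rw [evL_eq f (n := L.length) (by simp) (fun i => (L.get i).2) fun i hi => by simp]
  convert h1 using 2
  rw [← List.sum_ofFn]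
  have h2 : ∀ L : List (ℤ × V), (L.map fun x => x.1 - 1).sum = (L.map Prod.fst).sum - L.length := by
    intro L
    induction L with
    | nil => simp
    | cons x L ih => simp [ih]; ring
  rw [h2, show (List.ofFn fun i => (L.get i).1) = L.map Prod.fst from
    List.ext_getElem (by simp) fun i _ _ => by simp]
  ring

theorem IsHom.isHomogeneous {Φ : List V → V} {e : ℤ} (hΦ : IsHom 𝒱 Φ e) (h : IsML Φ) (n : ℕ) :
    IsHomogeneous 𝒱 𝒱 (h.toMultilinearMap n) (e - n) := by
  intro deg a ha
  have h1 := hΦ (List.ofFn fun i => (deg i, a i)) fun x hx => by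
    obtain ⟨i, rfl⟩ := List.mem_ofFn' _ _ |>.1 hx
    exact ha i
  convert h1 using 2
  · rw [List.map_ofFn, List.sum_ofFn]
    simp
    ring
  · change Φ _ = Φ _
    rw [List.map_ofFn]
    rfl

/-- A condition on lists of vectors that is linear in each entry holds for all lists if it holds
for lists of homogeneous vectors. -/
theorem forall_list_of_homogeneous (hV : ⨆ i, 𝒱 i = ⊤) {P : List V → Prop}
    (h0 : ∀ l₁ l₂, P (l₁ ++ 0 :: l₂))
    (hadd : ∀ l₁ l₂ x y, P (l₁ ++ x :: l₂) → P (l₁ ++ y :: l₂) → P (l₁ ++ (x + y) :: l₂))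
    (hP : ∀ l : List V, (∀ x ∈ l, ∃ i, x ∈ 𝒱 i) → P l) (l : List V) : P l := by
  suffices ∀ l₁ : List V, (∀ x ∈ l₁, ∃ i, x ∈ 𝒱 i) → P (l₁ ++ l) from this [] (by simp)
  induction l with
  | nil => intro l₁ h; rw [List.append_nil]; exact hP l₁ h
  | cons x w ih =>
    intro l₁ hl₁
    have hx : x ∈ ⨆ i, 𝒱 i := hV ▸ Submodule.mem_top
    induction hx using Submodule.iSup_induction' with
    | mem i x hx =>
      have := ih (l₁ ++ [x]) fun y hy => by
        rcases List.mem_append.1 hy with h | h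
        · exact hl₁ y h
        · exact ⟨i, List.mem_singleton.1 h ▸ hx⟩
      simpa using this
    | zero => exact h0 _ _
    | add x y _ _ hx hy => exact hadd _ _ _ _ hx hy

theorem exists_isSign (h𝒱 : DirectSum.IsInternal 𝒱) : ∃ ε : V →ₗ[ℝ] V, IsSign 𝒱 ε := by
  let e := LinearEquiv.ofBijective (DirectSum.coeLinearMap 𝒱) h𝒱
  refine ⟨DirectSum.toModule ℝ ℤ V (fun i => (-1 : ℝ) ^ (i - 1) • (𝒱 i).subtype) ∘ₗ
    e.symm.toLinearMap, fun i x hx => ?_⟩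
  have : e.symm x = DirectSum.lof ℝ ℤ (fun i => 𝒱 i) i ⟨x, hx⟩ := by
    rw [LinearEquiv.symm_apply_eq]
    exact (DirectSum.coeLinearMap_lof 𝒱 i ⟨x, hx⟩).symm
  simp [this]

/-- A map of reduced degree 0 preserves the parity of the reduced degree. By multilinearity it
suffices to test homogeneous entries. -/
theorem IsHom.map_sign (hV : ⨆ i, 𝒱 i = ⊤) {ε : V →ₗ[ℝ] V} (hε : IsSign 𝒱 ε) {A : List V → V}
    (hA : IsML A) (hh : IsHom 𝒱 A 1) (l : List V) : A (l.map ε) = ε (A l) := by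
  refine forall_list_of_homogeneous hV (P := fun l => A (l.map ε) = ε (A l)) ?_ ?_ ?_ l
  · intro l₁ l₂
    rw [hA.zero_mem (by simp), hA.zero_mem (by simp), map_zero]
  · intro l₁ l₂ x y hx hy
    simp only [List.map_append, List.map_cons, map_add] at hx hy ⊢
    rw [(hA _ _).map_add, (hA l₁ l₂).map_add, hx, hy, map_add]
  · intro l hl
    obtain ⟨L, hL, rfl⟩ : ∃ L : List (ℤ × V), (∀ x ∈ L, x.2 ∈ 𝒱 x.1) ∧ L.map Prod.snd = l := by
      choose! d hd using hl
      exact ⟨l.map fun x => (d x, x), by simpa using hd, by simp [Function.comp_def]⟩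
    rw [hε _ _ (hh L hL), add_sub_cancel_right]
    -- Only multilinearity is needed from here on, so the induction may replace `A` by `A` with its
    -- first entry fixed.
    clear hh hl
    induction L generalizing A with
    | nil => simp
    | cons x L ih =>
      simp only [List.map_cons, List.sum_cons]
      rw [ih (hA.cons _) fun y hy => hL y (List.mem_cons_of_mem _ hy),
        hε _ _ (hL x List.mem_cons_self)]
      have := (hA [] (L.map Prod.snd)).map_smul ((-1 : ℝ) ^ (x.1 - 1)) x.2
      simp only [List.nil_append] at this
      rw [this, smul_smul, ← zpow_add₀ (by norm_num), add_comm]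

end Sequences

/-! ### Iterated integrals of trees -/

section Trees

variable {V : Type*} [AddCommGroup V] [Module ℝ V]

/-- All integrals in the iterated integral of `g` over a simplex with vertices in `[0, 1]` are
integrals of continuous functions. -/
def SimplexCont (q : ℝ) : (k : ℕ) → ((Fin k → ℝ) → ℝ) → Prop
  | 0, _ => True
  | k + 1, g => (∀ s ∈ Set.Icc (0 : ℝ) 1, SimplexCont q k fun t => g (Fin.cons s t)) ∧
      ContinuousOn (fun s => simplexIntegral k s q fun t => g (Fin.cons s t)) (Set.Icc 0 1)

/-- Additivity of an iterated interval integral needs integrability at every stage, so continuity is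
carried through the induction. -/
theorem simplexCont_add {q : ℝ} (hq : q ∈ Set.Icc (0 : ℝ) 1) {k : ℕ} {g h : (Fin k → ℝ) → ℝ}
    (hg : SimplexCont q k g) (hh : SimplexCont q k h) :
    SimplexCont q k (fun t => g t + h t) ∧ ∀ p ∈ Set.Icc (0 : ℝ) 1,
      simplexIntegral k p q (fun t => g t + h t) =
        simplexIntegral k p q g + simplexIntegral k p q h := by
  induction k with
  | zero => exact ⟨trivial, fun _ _ => rfl⟩
  | succ k ih =>
    have h1 := fun s hs => ih (hg.1 s hs) (hh.1 s hs)
    refine ⟨⟨fun s hs => (h1 s hs).1, ?_⟩, fun p hp => ?_⟩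
    · exact (hg.2.fun_add hh.2).congr fun s hs => (h1 s hs).2 s hs
    · have hsub := Set.uIcc_subset_Icc hp hq
      rw [simplexIntegral, simplexIntegral, simplexIntegral, ← intervalIntegral.integral_add
        (hg.2.mono hsub).intervalIntegrable (hh.2.mono hsub).intervalIntegrable]
      exact intervalIntegral.integral_congr fun s hs => (h1 s (hsub hs)).2 s (hsub hs)

theorem simplexCont_zero (q : ℝ) (k : ℕ) : SimplexCont q k (fun _ => 0) ∧
    ∀ p, simplexIntegral k p q (fun _ => 0) = 0 := by
  induction k with
  | zero => exact ⟨trivial, fun _ => rfl⟩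
  | succ k ih =>
    refine ⟨⟨fun s hs => ih.1, ?_⟩, fun p => ?_⟩
    · simpa only [ih.2] using continuousOn_const
    · rw [simplexIntegral]
      simp only [ih.2, intervalIntegral.integral_zero]

/-- `y` is the iterated integral of `T` over the simplex from `p` to `q`, tested against all linear
functionals. -/
def IsSimplexInt (q : ℝ) (k : ℕ) (p : ℝ) (T : (Fin k → ℝ) → V) (y : V) : Prop :=
  ∀ φ : Module.Dual ℝ V, SimplexCont q k (fun t => φ (T t)) ∧
    φ y = simplexIntegral k p q fun t => φ (T t)

theorem IsSimplexInt.add {q : ℝ} (hq : q ∈ Set.Icc (0 : ℝ) 1) {k : ℕ} {p : ℝ}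
    (hp : p ∈ Set.Icc (0 : ℝ) 1) {T T' : (Fin k → ℝ) → V} {y y' : V}
    (h : IsSimplexInt q k p T y) (h' : IsSimplexInt q k p T' y') :
    IsSimplexInt q k p (fun t => T t + T' t) (y + y') := fun φ => by
  have := simplexCont_add hq (h φ).1 (h' φ).1
  simp only [map_add]
  exact ⟨this.1, by rw [this.2 p hp, (h φ).2, (h' φ).2]⟩

theorem IsSimplexInt.zero (q : ℝ) (k : ℕ) (p : ℝ) :
    IsSimplexInt q k p (fun _ => (0 : V)) 0 := fun φ => by
  simp only [map_zero]
  exact ⟨(simplexCont_zero q k).1, ((simplexCont_zero q k).2 p).symm⟩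

theorem IsSimplexInt.spl {q : ℝ} (hq : q ∈ Set.Icc (0 : ℝ) 1) {k : ℕ} {p : ℝ}
    (hp : p ∈ Set.Icc (0 : ℝ) 1) {K : (Fin k → ℝ) → List V → List V → V} {G : List V → List V → V}
    (h : ∀ v u, IsSimplexInt q k p (fun t => K t v u) (G v u)) (l : List V) :
    IsSimplexInt q k p (fun t => spl (K t) l) (spl G l) := by
  induction l generalizing K G with
  | nil => exact h [] []
  | cons x w ih => exact (h [] (x :: w)).add hq hp (ih fun v u => h (x :: v) u)

/-- With `g` independent of the integration variables, an insertion is a finite sum of values of `Φ`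
at fixed lists, so it commutes with integration. -/
theorem IsSimplexInt.ins {q : ℝ} (hq : q ∈ Set.Icc (0 : ℝ) 1) {k : ℕ} {p : ℝ}
    (hp : p ∈ Set.Icc (0 : ℝ) 1) {σ : V →ₗ[ℝ] V} {g : List V → V} {Φ : (Fin k → ℝ) → List V → V}
    {G : List V → V} (h : ∀ l, IsSimplexInt q k p (fun t => Φ t l) (G l)) (l : List V) :
    IsSimplexInt q k p (fun t => ins σ g (Φ t) l) (ins σ g G l) := by
  induction l generalizing Φ G with
  | nil => exact IsSimplexInt.zero q k p
  | cons x w ih =>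
    exact (IsSimplexInt.spl hq hp (fun v u => h (g (x :: v) :: u)) w).add hq hp (ih fun l => h _)

/-- The sum of all trees with `k` levels. -/
def treeL (A : ℝ → List V → V) : (k : ℕ) → (Fin k → ℝ) → List V → V
  | 0, _, l => single l
  | k + 1, t, l => ins .id (A (t 0)) (treeL A k (Fin.tail t)) l

theorem treeSum_eq (A : ℝ → ∀ r : ℕ, MultilinearMap ℝ (fun _ : Fin r => V) V) (k n : ℕ)
    (t : Fin k → ℝ) (a : ℕ → V) :
    treeSum A k n t a = treeL (fun s => evL (A s)) k t (seqL n a) := by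
  induction k generalizing n a with
  | zero =>
    rw [treeSum, treeL]
    split_ifs with h
    · subst h; rfl
    · exact (single_of_length_ne (by simpa using h)).symm
  | succ k ih =>
    rw [treeSum, treeL, ins_seqL]
    refine Finset.sum_congr rfl fun m hm => Finset.sum_congr rfl fun j hj => ?_
    rw [Finset.mem_Icc] at hm
    rw [Finset.mem_range] at hj
    rw [ih, LinearMap.id_coe, List.map_id, ← seqL_insertAt (by omega) hm.1, evL_seqL]

/-- The nested vector-valued integrals agree with the scalar iterated integral because the outermost
variable decorates the level next to the leaves and the inner integrals pass through that insertion.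
-/
theorem treeInt_isSimplexInt {A : ℝ → List V → V} (hA : IsConnection A) {q : ℝ}
    (hq : q ∈ Set.Icc (0 : ℝ) 1) (k : ℕ) {p : ℝ} (hp : p ∈ Set.Icc (0 : ℝ) 1) (l : List V) :
    IsSimplexInt q k p (fun t => treeL A k t l) (treeInt A q k p l) := by
  induction k generalizing p l with
  | zero => exact fun φ => ⟨trivial, rfl⟩
  | succ k ih =>
    intro φ
    have h1 : ∀ s ∈ Set.Icc (0 : ℝ) 1, IsSimplexInt q k s
        (fun t => treeL A (k + 1) (Fin.cons s t) l) (ins .id (A s) (treeInt A q k s) l) :=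
      fun s hs => by
        simp only [treeL, Fin.cons_zero, Fin.tail_cons]
        exact IsSimplexInt.ins hq hs (fun l => ih hs l) l
    have h2 := treeInt_wCont_ins hA hq k l
    refine ⟨⟨fun s hs => (h1 s hs φ).1, ?_⟩, ?_⟩
    · exact (h2 φ).congr fun s hs => (h1 s hs φ).2.symm
    · rw [treeInt, clamp_of_mem hp, h2.wInt_spec hp hq, simplexIntegral]
      exact intervalIntegral.integral_congr fun s hs =>
        (h1 s (Set.uIcc_subset_Icc hp hq hs) φ).2

theorem transport_eq_simplexIntegral {A : ℝ → List V → V} (hA : IsConnection A) {q : ℝ}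
    (hq : q ∈ Set.Icc (0 : ℝ) 1) {p : ℝ} (hp : p ∈ Set.Icc (0 : ℝ) 1) {N : ℕ} {l : List V}
    (hN : l.length ≤ N) (φ : Module.Dual ℝ V) :
    φ (transport A q p l) = ∑ i ∈ Finset.range N, (-1 : ℝ) ^ i *
      simplexIntegral i p q fun t => φ (treeL A i t l) := by
  rw [transport_eq hA hq hN, map_sum]
  refine Finset.sum_congr rfl fun i _ => ?_
  rw [map_smul, smul_eq_mul, (treeInt_isSimplexInt hA hq i hp l φ).2]

end Trees

/-! ### Change of the underlying vector space -/

section Conj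

variable {V : Type*} [AddCommGroup V] [Module ℝ V] {W : Type*} [AddCommGroup W] [Module ℝ W]
  {X : Type*} [AddCommGroup X] [Module ℝ X] {Y : Type*} [AddCommGroup Y] [Module ℝ Y]

/-- A multilinear map transported along linear equivalences of the source and target. -/
def conj (e : X ≃ₗ[ℝ] V) (e' : Y ≃ₗ[ℝ] W) {n : ℕ} (f : MultilinearMap ℝ (fun _ : Fin n => X) Y) :
    MultilinearMap ℝ (fun _ : Fin n => V) W :=
  e'.toLinearMap.compMultilinearMap (f.compLinearMap fun _ => e.symm.toLinearMap)

@[simp] theorem conj_apply (e : X ≃ₗ[ℝ] V) (e' : Y ≃ₗ[ℝ] W) {n : ℕ}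
    (f : MultilinearMap ℝ (fun _ : Fin n => X) Y) (a : Fin n → V) :
    conj e e' f a = e' (f fun i => e.symm (a i)) := rfl

theorem map_insertAt (f : X → V) (a : ℕ → X) (j r : ℕ) (x : X) (i : ℕ) :
    f (insertAt a j r x i) = insertAt (fun i => f (a i)) j r (f x) i := by
  unfold insertAt
  split_ifs <;> rfl

theorem gComp_conj (e : X ≃ₗ[ℝ] V) (e' : Y ≃ₗ[ℝ] W) {k r : ℕ}
    (f : MultilinearMap ℝ (fun _ : Fin k => X) Y) (g : MultilinearMap ℝ (fun _ : Fin r => X) X)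
    (d : ℤ) (deg : ℕ → ℤ) (a : ℕ → V) :
    gComp (conj e e' f) (conj e e g) d deg a =
      e' (gComp f g d deg fun i => e.symm (a i)) := by
  simp only [gComp, map_sum, map_smul, conj_apply]
  refine Finset.sum_congr rfl fun j _ => ?_
  simp only [map_insertAt e.symm, LinearEquiv.symm_apply_apply]

theorem isHomogeneous_conj {𝒱 : ℤ → Submodule ℝ V} {𝒲 : ℤ → Submodule ℝ W}
    {𝒳 : ℤ → Submodule ℝ X} {𝒴 : ℤ → Submodule ℝ Y} {e : X ≃ₗ[ℝ] V} {e' : Y ≃ₗ[ℝ] W}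
    (he : ∀ i x, e x ∈ 𝒱 i ↔ x ∈ 𝒳 i) (he' : ∀ i x, e' x ∈ 𝒲 i ↔ x ∈ 𝒴 i) {n : ℕ}
    {f : MultilinearMap ℝ (fun _ : Fin n => X) Y} {k : ℤ} (hf : IsHomogeneous 𝒳 𝒴 f k) :
    IsHomogeneous 𝒱 𝒲 (conj e e' f) k := fun deg a ha => by
  rw [conj_apply, he']
  exact hf deg _ fun i => by rw [← he, LinearEquiv.apply_symm_apply]; exact ha i

theorem isInternal_of_linearEquiv {𝒱 : ℤ → Submodule ℝ V} {𝒳 : ℤ → Submodule ℝ X}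
    (e : X ≃ₗ[ℝ] V) (he : ∀ i x, e x ∈ 𝒱 i ↔ x ∈ 𝒳 i) (h : DirectSum.IsInternal 𝒱) :
    DirectSum.IsInternal 𝒳 := by
  have h1 : 𝒳 = Submodule.orderIsoMapComap e.symm ∘ 𝒱 := by
    funext i
    ext x
    rw [← he]
    simp [Submodule.orderIsoMapComap, Submodule.mem_map_equiv]
  rw [DirectSum.isInternal_submodule_iff_iSupIndep_and_iSup_eq_top] at h ⊢
  refine ⟨h1 ▸ (iSupIndep_map_orderIso_iff _).2 h.1, ?_⟩
  rw [h1]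
  change ⨆ i, Submodule.orderIsoMapComap e.symm (𝒱 i) = ⊤
  rw [← OrderIso.map_iSup, h.2, OrderIso.map_top]

end Conj

/-! ### Paths in charts -/

section Charts

variable {E : Type*} [NormedAddCommGroup E] [NormedSpace ℝ E]
  {H : Type*} [TopologicalSpace H] {I : ModelWithCorners ℝ E H}
  {M : Type*} [TopologicalSpace M] [ChartedSpace H M]
  {γ : ℝ → M} {t : ℝ}

theorem contDiffWithinAt_chart_comp (hγ : ContMDiffOn 𝓘(ℝ, ℝ) I 1 γ (Set.Icc 0 1))
    (ht : t ∈ Set.Icc (0 : ℝ) 1) :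
    ContDiffWithinAt ℝ 1 (extChartAt I (γ t) ∘ γ) (Set.Icc 0 1) t :=
  (contMDiffWithinAt_iff_target.1 (hγ t ht)).2.contDiffWithinAt

theorem mapsTo_chart_range (x : M) (s : Set ℝ) :
    Set.MapsTo (extChartAt I x ∘ γ) s (Set.range I) := fun s _ => by
  simp [extChartAt]

theorem eventually_mem_chart (hγ : ContMDiffOn 𝓘(ℝ, ℝ) I 1 γ (Set.Icc 0 1))
    (ht : t ∈ Set.Icc (0 : ℝ) 1) :
    ∀ᶠ s in 𝓝[Set.Icc (0 : ℝ) 1] t, γ s ∈ (extChartAt I (γ t)).source :=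
  (hγ.continuousOn t ht) (extChartAt_source_mem_nhds (I := I) (γ t))

theorem mfderiv_chart_path [IsManifold I 1 M] (hγ : ContMDiffOn 𝓘(ℝ, ℝ) I 1 γ (Set.Icc 0 1))
    (ht : t ∈ Set.Icc (0 : ℝ) 1) :
    mfderiv I 𝓘(ℝ, E) (extChartAt I (γ t)) (γ t)
      (mfderivWithin 𝓘(ℝ, ℝ) I γ (Set.Icc 0 1) t (1 : ℝ)) =
      fderivWithin ℝ (extChartAt I (γ t) ∘ γ) (Set.Icc 0 1) t (1 : ℝ) := by
  have h := mfderiv_comp_mfderivWithin t (g := extChartAt I (γ t)) (I' := I)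
    (mdifferentiableAt_extChartAt (mem_chart_source H (γ t)))
    ((hγ t ht).mdifferentiableWithinAt one_ne_zero)
    ((uniqueDiffOn_Icc zero_lt_one).uniqueMDiffOn t ht)
  rw [mfderivWithin_eq_fderivWithin] at h
  rw [h]
  rfl

/-- Near time `t` the path is the inverse chart composed with its coordinate expression; the chain
rule recovers the velocity at `s` from coordinates centred at `γ t`. -/
theorem mfderivWithin_path [IsManifold I 1 M] (hγ : ContMDiffOn 𝓘(ℝ, ℝ) I 1 γ (Set.Icc 0 1))
    {s : ℝ} (hs : s ∈ Set.Icc (0 : ℝ) 1)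
    (hc : γ s ∈ (extChartAt I (γ t)).source) :
    (mfderivWithin 𝓘(ℝ, ℝ) I γ (Set.Icc 0 1) s (1 : ℝ) : E) =
      mfderivWithin 𝓘(ℝ, E) I (extChartAt I (γ t)).symm (Set.range I) (extChartAt I (γ t) (γ s))
        (fderivWithin ℝ (extChartAt I (γ t) ∘ γ) (Set.Icc 0 1) s (1 : ℝ)) := by
  have hu := (uniqueDiffOn_Icc (zero_lt_one (α := ℝ))).uniqueMDiffOn s hs
  have hγs := (hγ s hs).mdifferentiableWithinAt one_ne_zero
  have hc' : γ s ∈ (chartAt H (γ t)).source := by rwa [extChartAt_source] at hc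
  have h1 := mfderivWithin_comp s (g := (extChartAt I (γ t)).symm) (f := extChartAt I (γ t) ∘ γ)
    (I := 𝓘(ℝ, ℝ)) (I' := 𝓘(ℝ, E)) (I'' := I) (u := Set.range I) (s := Set.Icc 0 1)
    (mdifferentiableWithinAt_extChartAt_symm ((extChartAt I (γ t)).map_source hc))
    ((mdifferentiableAt_extChartAt hc').comp_mdifferentiableWithinAt s hγs)
    (mapsTo_chart_range (γ t) _) hu
  have h2 : ((extChartAt I (γ t)).symm ∘ extChartAt I (γ t) ∘ γ) =ᶠ[𝓝[Set.Icc (0 : ℝ) 1] s] γ := by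
    have : ∀ᶠ s' in 𝓝[Set.Icc (0 : ℝ) 1] s, γ s' ∈ (extChartAt I (γ t)).source :=
      (hγ.continuousOn s hs) (extChartAt_source_mem_nhds' hc)
    filter_upwards [this] with s' hs'
    exact (extChartAt I (γ t)).left_inv hs'
  have h3 := h2.mfderivWithin_eq (I := 𝓘(ℝ, ℝ)) (I' := I) ((extChartAt I (γ t)).left_inv hc)
  rw [mfderivWithin_eq_fderivWithin] at h1
  have h4 := h3.symm.trans h1
  exact congrArg (fun D : ℝ →L[ℝ] E => D 1) h4

end Charts

/-! ### Forms along a path -/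

section Path

variable {E : Type*} [NormedAddCommGroup E] [NormedSpace ℝ E]
  {H : Type*} [TopologicalSpace H] {I : ModelWithCorners ℝ E H}
  {M : Type*} [TopologicalSpace M] [ChartedSpace H M]
  {V : Type*} [AddCommGroup V] [Module ℝ V] {𝒱 : ℤ → Submodule ℝ V}
  {L : LocalSystem M 𝒱}

/-- The coefficient of `α` at `y` in the trivialisation `b`, on the tangent vectors `w`. -/
def pointForm (α : HochschildForm I L) (m n : ℕ) (b : L.ι) (φ : Module.Dual ℝ V)
    (a : Fin n → V) (y : M) (w : Fin m → E) : ℝ :=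
  φ (L.triv b y (α m n y w fun i => (L.triv b y).symm (a i)))

theorem localForm_eq (α : HochschildForm I L) (m n : ℕ) (b : L.ι) {x y : M} (φ : Module.Dual ℝ V)
    (a : Fin n → V) (v : Fin m → E) (hy : y ∈ (extChartAt I x).source) :
    localForm α m n b x φ a (extChartAt I x y) v = pointForm α m n b φ a y fun i =>
      mfderivWithin 𝓘(ℝ, E) I (extChartAt I x).symm (Set.range I) (extChartAt I x y) (v i) := by
  change pointForm α m n b φ a ((extChartAt I x).symm (extChartAt I x y)) _ = _
  rw [(extChartAt I x).left_inv hy]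

theorem localForm_isLinearMap (α : HochschildForm I L) (n : ℕ) (b : L.ι) (x : M)
    (φ : Module.Dual ℝ V) (a : Fin n → V) (e : E) :
    IsLinearMap ℝ fun v : E => localForm α 1 n b x φ a e fun _ => v := by
  set y := (extChartAt I x).symm e
  set D : E →L[ℝ] E := mfderivWithin 𝓘(ℝ, E) I (extChartAt I x).symm (Set.range I) e
  let ℓ : E →ₗ[ℝ] MultilinearMap ℝ (fun _ : Fin n => L.fiber y) (L.fiber y) :=
    (AlternatingMap.ofSubsingleton ℝ E _ (0 : Fin 1)).symm (α 1 n y)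
  have : ∀ v, localForm α 1 n b x φ a e (fun _ => v) =
      φ (L.triv b y (ℓ (D v) fun i => (L.triv b y).symm (a i))) := fun v => rfl
  simp only [this]
  constructor
  · intro v w; simp
  · intro c v; simp

variable {γ : ℝ → M} (ψ : FlatTrivialization L γ)

/-- The transition from the trivialisation `ψ` along the path to the trivialisation `b`, at time
`t`. -/
def FlatTrivialization.transition (b : L.ι) (t : ℝ) : V ≃ₗ[ℝ] V :=
  (ψ.toEquiv t).symm.trans (L.triv b (γ t))

/-- The coefficients of `α` at `γ t` on the tangent vectors `w`, in the trivialisation `ψ`. -/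
def pathForm (α : HochschildForm I L) (m : ℕ) (t : ℝ) (w : Fin m → E) (n : ℕ) :
    MultilinearMap ℝ (fun _ : Fin n => V) V :=
  conj (ψ.toEquiv t) (ψ.toEquiv t) (α m n (γ t) w)

/-- Where the transition between the two flat trivializations is constant, changing from one to the
other only conjugates by one fixed isomorphism, which can be moved onto the functional and the
inputs. -/
theorem pathForm_eq (α : HochschildForm I L) (m n : ℕ) {b : L.ι} {s t : ℝ} (w : Fin m → E)
    (φ : Module.Dual ℝ V) (a : Fin n → V)
    (h : ∀ v, L.triv b (γ s) ((ψ.toEquiv s).symm v) = L.triv b (γ t) ((ψ.toEquiv t).symm v)) :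
    φ (pathForm ψ α m s w n a) =
      pointForm α m n b (φ ∘ₗ (ψ.transition b t).symm.toLinearMap)
        (fun i => ψ.transition b t (a i)) (γ s) w := by
  have h1 : ∀ v, (L.triv b (γ s)).symm (ψ.transition b t v) = (ψ.toEquiv s).symm v := fun v => by
    rw [LinearEquiv.symm_apply_eq, h]; rfl
  have h2 : ∀ z, (ψ.transition b t).symm (L.triv b (γ s) z) = ψ.toEquiv s z := fun z => by
    rw [LinearEquiv.symm_apply_eq]
    change _ = L.triv b (γ t) ((ψ.toEquiv t).symm (ψ.toEquiv s z))
    rw [← h, LinearEquiv.symm_apply_apply]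
  simp only [pathForm, pointForm, conj_apply, LinearMap.comp_apply, LinearEquiv.coe_coe, h1, h2]

theorem pathForm_eventuallyEq {α : HochschildForm I L}
    (hγ : ContMDiffOn 𝓘(ℝ, ℝ) I 1 γ (Set.Icc 0 1)) {t : ℝ} (ht : t ∈ Set.Icc (0 : ℝ) 1) {b : L.ι}
    (hb : γ t ∈ L.baseSet b) :
    ∀ᶠ s in 𝓝[Set.Icc (0 : ℝ) 1] t, γ s ∈ (extChartAt I (γ t)).source ∧
      ∀ (m n : ℕ) (w : Fin m → E) (φ : Module.Dual ℝ V) (a : Fin n → V),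
        φ (pathForm ψ α m s w n a) =
          pointForm α m n b (φ ∘ₗ (ψ.transition b t).symm.toLinearMap)
            (fun i => ψ.transition b t (a i)) (γ s) w := by
  filter_upwards [eventually_mem_chart hγ ht, ψ.flat b t ht hb] with s h1 h2
  exact ⟨h1, fun m n w φ a => pathForm_eq ψ α m n w φ a h2⟩

/-- Locally the coefficient is a finite sum of velocity components times components of the form in a
basis of `E`. The former are continuous because the path is C¹, the latter because the form is
smooth. -/
theorem pullbackOne_wCont [FiniteDimensional ℝ E] [IsManifold I 1 M] {α : HochschildForm I L}
    (hα : IsSmooth α) (hγ : ContMDiffOn 𝓘(ℝ, ℝ) I 1 γ (Set.Icc 0 1)) (n : ℕ) (a : Fin n → V) :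
    WCont fun t => pullbackOne α γ ψ t n a := by
  intro φ t ht
  obtain ⟨b, hb⟩ := L.exists_mem_baseSet (γ t)
  set φ' := φ ∘ₗ (ψ.transition b t).symm.toLinearMap
  set a' := fun i => ψ.transition b t (a i)
  set c := extChartAt I (γ t) ∘ γ
  let B := Module.finBasis ℝ E
  have hc : ContDiffWithinAt ℝ 1 c (Set.Icc 0 1) t := contDiffWithinAt_chart_comp hγ ht
  have hc' : ContinuousWithinAt (fun s => fderivWithin ℝ c (Set.Icc 0 1) s (1 : ℝ))
      (Set.Icc 0 1) t :=
    ((hc.fderivWithin_right (m := 0) (uniqueDiffOn_Icc zero_lt_one) (by norm_num) ht).continuousWithinAt).clm_apply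
      continuousWithinAt_const
  have h1 : ∀ s ∈ Set.Icc (0 : ℝ) 1, γ s ∈ (extChartAt I (γ t)).source →
      pointForm α 1 n b φ' a' (γ s)
        (fun _ => mfderivWithin 𝓘(ℝ, ℝ) I γ (Set.Icc 0 1) s (1 : ℝ)) =
      ∑ k, B.coord k (fderivWithin ℝ c (Set.Icc 0 1) s (1 : ℝ)) *
        localForm α 1 n b (γ t) φ' a' (c s) (fun _ => B k) := by
    intro s hs hcs
    have h2 := localForm_isLinearMap α n b (γ t) φ' a' (c s)
    have h3 := localForm_eq α 1 n b φ' a'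
      (fun _ => fderivWithin ℝ c (Set.Icc 0 1) s (1 : ℝ)) hcs
    rw [mfderivWithin_path hγ hs hcs, ← h3]
    change h2.mk' _ (fderivWithin ℝ c (Set.Icc 0 1) s (1 : ℝ)) = _
    conv_lhs => rw [← B.sum_repr (fderivWithin ℝ c (Set.Icc 0 1) s (1 : ℝ))]
    rw [map_sum]
    refine Finset.sum_congr rfl fun k _ => ?_
    rw [map_smul]
    rfl
  have h2 : ContinuousWithinAt (fun s => ∑ k, B.coord k (fderivWithin ℝ c (Set.Icc 0 1) s (1 : ℝ)) *
      localForm α 1 n b (γ t) φ' a' (c s) (fun _ => B k)) (Set.Icc 0 1) t := by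
    refine tendsto_finsetSum _ fun k _ => ContinuousWithinAt.mul ?_ ?_
    · exact (LinearMap.continuous_of_finiteDimensional (B.coord k)).continuousAt.comp_continuousWithinAt hc'
    · exact ContinuousWithinAt.comp (t := Set.range I)
        (g := fun e => localForm α 1 n b (γ t) φ' a' e fun _ => B k) (f := c)
        (hα 1 n b (γ t) hb φ' a' (fun _ => B k)).continuousWithinAt hc.continuousWithinAt
        (mapsTo_chart_range (γ t) _)
  have h3 : ∀ᶠ s in 𝓝[Set.Icc (0 : ℝ) 1] t, φ (pullbackOne α γ ψ s n a) =
      ∑ k, B.coord k (fderivWithin ℝ c (Set.Icc 0 1) s (1 : ℝ)) *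
        localForm α 1 n b (γ t) φ' a' (c s) (fun _ => B k) := by
    filter_upwards [pathForm_eventuallyEq (α := α) ψ hγ ht hb, self_mem_nhdsWithin] with s hs hs'
    exact (hs.2 1 n _ φ a).trans (h1 s hs' hs.1)
  exact h2.congr_of_eventuallyEq h3 (h3.self_of_nhdsWithin ht)

/-- Chain rule in the chart at `γ t`. For a 0-form the alternating sum in the exterior derivative
has a single term, the directional derivative along the velocity. -/
theorem pathForm_zero_hasDerivWithinAt [IsManifold I 1 M] {α : HochschildForm I L}
    (hα : IsSmooth α) (hγ : ContMDiffOn 𝓘(ℝ, ℝ) I 1 γ (Set.Icc 0 1)) {t : ℝ}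
    (ht : t ∈ Set.Icc (0 : ℝ) 1) {b : L.ι} (hb : γ t ∈ L.baseSet b) (n : ℕ) (φ : Module.Dual ℝ V)
    (a : Fin n → V) :
    HasDerivWithinAt (fun s => φ (pathForm ψ α 0 s Fin.elim0 n a))
      (covariantDeriv α 1 n b (γ t) (φ ∘ₗ (ψ.transition b t).symm.toLinearMap)
        (fun i => ψ.transition b t (a i))
        fun _ => mfderivWithin 𝓘(ℝ, ℝ) I γ (Set.Icc 0 1) t (1 : ℝ)) (Set.Icc 0 1) t := by
  set φ' := φ ∘ₗ (ψ.transition b t).symm.toLinearMap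
  set a' := fun i => ψ.transition b t (a i)
  set c := extChartAt I (γ t) ∘ γ
  have hc : ContDiffWithinAt ℝ 1 c (Set.Icc 0 1) t := contDiffWithinAt_chart_comp hγ ht
  have hd : DifferentiableWithinAt ℝ (fun e => localForm α 0 n b (γ t) φ' a' e Fin.elim0)
      (Set.range I) (c t) :=
    (hα 0 n b (γ t) hb φ' a' Fin.elim0).differentiableWithinAt (by simp)
  have h1 := hd.hasFDerivWithinAt.comp_hasDerivWithinAt t
    (hc.differentiableWithinAt one_ne_zero).hasFDerivWithinAt.hasDerivWithinAt
    (mapsTo_chart_range (γ t) _)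
  have h3 : ∀ᶠ s in 𝓝[Set.Icc (0 : ℝ) 1] t, φ (pathForm ψ α 0 s Fin.elim0 n a) =
      localForm α 0 n b (γ t) φ' a' (c s) Fin.elim0 := by
    filter_upwards [pathForm_eventuallyEq (α := α) ψ hγ ht hb] with s hs
    rw [hs.2 0 n _ φ a]
    refine Eq.trans ?_ (localForm_eq α 0 n b φ' a' Fin.elim0 hs.1).symm
    congr 1
    exact Subsingleton.elim _ _
  refine (h1.congr_of_eventuallyEq h3 (h3.self_of_nhdsWithin ht)).congr_deriv ?_
  refine Eq.trans ?_ (Fintype.sum_subsingleton _ (0 : Fin 1)).symm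
  rw [Fin.val_zero, pow_zero, one_mul]
  refine congrArg₂ (fun (f : E → ℝ) (u : E) => fderivWithin ℝ f (Set.range I) (c t) u) ?_
    (mfderiv_chart_path hγ ht).symm
  funext e
  congr 1
  exact Subsingleton.elim _ _

theorem eq_structureMaps (α : HochschildForm I L) (x : M) (n : ℕ) (v : Fin 0 → TangentSpace I x) :
    α 0 n x v = structureMaps α x n :=
  congrArg (α 0 n x) (Subsingleton.elim _ _)

/-- For two operations of reduced degree 1 the bracket is symmetric; exchanging the two factors in
the sum accounts for the 2. -/
theorem selfBracket_zero (α : HochschildForm I L) (n : ℕ) (x : M) (v : Fin 0 → TangentSpace I x)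
    (deg : ℕ → ℤ) (a : ℕ → L.fiber x) :
    selfBracket α 0 n x v deg a = (2 : ℝ) •
      ∑ kr ∈ Finset.HasAntidiagonal.antidiagonal (n + 1),
        gComp (structureMaps α x kr.1) (structureMaps α x kr.2) 1 deg a := by
  have h : ∀ kr : ℕ × ℕ, gBracket (structureMaps α x kr.1) (structureMaps α x kr.2) 1 1 deg a =
      gComp (structureMaps α x kr.1) (structureMaps α x kr.2) 1 deg a +
        gComp (structureMaps α x kr.2) (structureMaps α x kr.1) 1 deg a := fun kr => by
    simp [gBracket]
  have h' : selfBracket α 0 n x v deg a =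
      ∑ kr ∈ Finset.HasAntidiagonal.antidiagonal (n + 1),
        gBracket (structureMaps α x kr.1) (structureMaps α x kr.2) 1 1 deg a := by
    refine (Fintype.sum_subsingleton _ (0 : Fin 1)).trans (Finset.sum_congr rfl fun kr _ => ?_)
    rw [Fintype.sum_subsingleton _ (1 : Equiv.Perm (Fin 0))]
    change ((((0).factorial * (0).factorial : ℕ) : ℝ)⁻¹ •
      ((Equiv.Perm.sign (1 : Equiv.Perm (Fin 0)) : ℤ) : ℝ) •
        (-1 : ℝ) ^ ((((0 : ℕ) : ℤ) - (0 : ℕ)) * (1 - ((0 : ℕ) : ℤ))) •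
          gBracket (α 0 kr.1 x _) (α 0 kr.2 x _) (1 - ((0 : ℕ) : ℤ))
            (1 - (((0 : ℕ) : ℤ) - (0 : ℕ))) deg a) = _
    rw [eq_structureMaps, eq_structureMaps]
    simp
  have h2 := Finset.Nat.sum_antidiagonal_swap (n := n + 1)
    (f := fun kr => gComp (structureMaps α x kr.1) (structureMaps α x kr.2) 1 deg a)
  simp only [Prod.fst_swap, Prod.snd_swap] at h2
  rw [h', Finset.sum_congr rfl fun kr _ => h kr, Finset.sum_add_distrib, h2, two_smul]

/-- The 1-form falls on either factor. The Koszul sign is -1 when it falls on the second, and the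
two contributions then coincide after exchanging arities. -/
theorem selfBracket_one (α : HochschildForm I L) (n : ℕ) (x : M) (u : TangentSpace I x)
    (deg : ℕ → ℤ) (a : ℕ → L.fiber x) :
    selfBracket α 1 n x (fun _ => u) deg a = (2 : ℝ) •
      (∑ kr ∈ Finset.HasAntidiagonal.antidiagonal (n + 1),
        gComp (α 1 kr.1 x fun _ => u) (structureMaps α x kr.2) 1 deg a -
      ∑ kr ∈ Finset.HasAntidiagonal.antidiagonal (n + 1),
        gComp (structureMaps α x kr.1) (α 1 kr.2 x fun _ => u) 0 deg a) := by
  have h : selfBracket α 1 n x (fun _ => u) deg a =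
      ∑ kr ∈ Finset.HasAntidiagonal.antidiagonal (n + 1),
        -(gComp (structureMaps α x kr.1) (α 1 kr.2 x fun _ => u) 0 deg a -
          gComp (α 1 kr.2 x fun _ => u) (structureMaps α x kr.1) 1 deg a) +
      ∑ kr ∈ Finset.HasAntidiagonal.antidiagonal (n + 1),
        (gComp (α 1 kr.1 x fun _ => u) (structureMaps α x kr.2) 1 deg a -
          gComp (structureMaps α x kr.2) (α 1 kr.1 x fun _ => u) 0 deg a) := by
    refine (Fin.sum_univ_two _).trans (congrArg₂ _ (Finset.sum_congr rfl fun kr _ => ?_)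
      (Finset.sum_congr rfl fun kr _ => ?_))
    · rw [Fintype.sum_subsingleton _ (1 : Equiv.Perm (Fin 1))]
      change ((((0).factorial * (1).factorial : ℕ) : ℝ)⁻¹ •
        ((Equiv.Perm.sign (1 : Equiv.Perm (Fin 1)) : ℤ) : ℝ) •
          (-1 : ℝ) ^ ((((1 : ℕ) : ℤ) - (0 : ℕ)) * (1 - ((0 : ℕ) : ℤ))) •
            gBracket (α 0 kr.1 x _) (α 1 kr.2 x fun _ => u) (1 - ((0 : ℕ) : ℤ))
              (1 - (((1 : ℕ) : ℤ) - (0 : ℕ))) deg a) = _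
      rw [eq_structureMaps]
      simp [gBracket]
    · rw [Fintype.sum_subsingleton _ (1 : Equiv.Perm (Fin 1))]
      change ((((1).factorial * (0).factorial : ℕ) : ℝ)⁻¹ •
        ((Equiv.Perm.sign (1 : Equiv.Perm (Fin 1)) : ℤ) : ℝ) •
          (-1 : ℝ) ^ ((((1 : ℕ) : ℤ) - (1 : ℕ)) * (1 - ((1 : ℕ) : ℤ))) •
            gBracket (α 1 kr.1 x fun _ => u) (α 0 kr.2 x _) (1 - ((1 : ℕ) : ℤ))
              (1 - (((1 : ℕ) : ℤ) - (1 : ℕ))) deg a) = _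
      rw [eq_structureMaps]
      simp [gBracket]
  have h1 := Finset.Nat.sum_antidiagonal_swap (n := n + 1)
    (f := fun kr => gComp (α 1 kr.1 x fun _ => u) (structureMaps α x kr.2) 1 deg a)
  have h2 := Finset.Nat.sum_antidiagonal_swap (n := n + 1)
    (f := fun kr => gComp (structureMaps α x kr.1) (α 1 kr.2 x fun _ => u) 0 deg a)
  simp only [Prod.fst_swap, Prod.snd_swap] at h1 h2
  rw [h, Finset.sum_neg_distrib, Finset.sum_sub_distrib, Finset.sum_sub_distrib, h1, h2, two_smul]
  abel

end Path

/-! ### Consequences of the Maurer–Cartan equation -/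

section MaurerCartan

variable {E : Type*} [NormedAddCommGroup E] [NormedSpace ℝ E]
  {H : Type*} [TopologicalSpace H] {I : ModelWithCorners ℝ E H}
  {M : Type*} [TopologicalSpace M] [ChartedSpace H M]
  {V : Type*} [AddCommGroup V] [Module ℝ V] {𝒱 : ℤ → Submodule ℝ V}
  {L : LocalSystem M 𝒱} {α : HochschildForm I L}

/-- The 0-form part of the Maurer–Cartan equation has no derivative term, and its bracket is twice
the A∞ relation. -/
theorem isAInfAlgebra_structureMaps (h𝒱 : DirectSum.IsInternal 𝒱) (hα : IsMaurerCartan α) (x : M) :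
    IsAInfAlgebra (L.grading x) (structureMaps α x) := by
  obtain ⟨b, hb⟩ := L.exists_mem_baseSet x
  refine ⟨isInternal_of_linearEquiv (L.triv b x) (L.triv_mem_iff b x hb) h𝒱, fun n => ?_,
    fun n deg a ha => ?_⟩
  · have := hα.homogeneous 0 n x Fin.elim0
    rwa [Nat.cast_zero, sub_zero] at this
  · apply (L.triv b x).injective
    refine dual_ext fun φ => ?_
    have h := hα.equation 0 n b x hb φ deg (fun i => L.triv b x (a i))
      (fun i => (L.triv_mem_iff b x hb _ _).2 (ha i)) Fin.elim0
    simp only [LinearEquiv.symm_apply_apply, selfBracket_zero, map_smul, covariantDeriv,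
      zero_add, smul_eq_mul] at h
    rw [map_zero, map_zero]
    linarith

variable {γ : ℝ → M} (ψ : FlatTrivialization L γ)

/-- The operations `μ^n` over `γ t`, in the trivialisation `ψ`. -/
def pathMaps (α : HochschildForm I L) (t : ℝ) (n : ℕ) : MultilinearMap ℝ (fun _ : Fin n => V) V :=
  conj (ψ.toEquiv t) (ψ.toEquiv t) (structureMaps α (γ t) n)

theorem isConnection_pullbackOne [FiniteDimensional ℝ E] [IsManifold I 1 M] (hα : IsSmooth α)
    (h11 : ∀ x, α 1 1 x = 0) (hγ : ContMDiffOn 𝓘(ℝ, ℝ) I 1 γ (Set.Icc 0 1)) :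
    IsConnection fun t => evL (pullbackOne α γ ψ t) where
  isML t := evL_isML _
  wCont l := pullbackOne_wCont ψ hα hγ l.length l.get
  unary t x := by
    change ψ.toEquiv t (α 1 1 (γ t) _ _) = 0
    rw [h11]
    simp

theorem pullbackOne_isHom (hα : IsMaurerCartan α) {t : ℝ} (ht : t ∈ Set.Icc (0 : ℝ) 1) :
    IsHom 𝒱 (evL (pullbackOne α γ ψ t)) 1 := by
  refine evL_isHom fun n => ?_
  have h := isHomogeneous_conj (ψ.mem_iff t ht) (ψ.mem_iff t ht) (hα.homogeneous 1 n (γ t) fun _ =>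
    mfderivWithin 𝓘(ℝ, ℝ) I γ (Set.Icc 0 1) t (1 : ℝ))
  rw [show (1 : ℤ) - n = 2 - (1 : ℕ) - n by push_cast; ring]
  exact h

theorem exists_seqL_eq {l : List V} (hl : ∀ x ∈ l, ∃ i, x ∈ 𝒱 i) :
    ∃ (deg : ℕ → ℤ) (a : ℕ → V), (∀ i, a i ∈ 𝒱 (deg i)) ∧ seqL l.length a = l := by
  have h : ∀ i, ∃ d, l.getD i 0 ∈ 𝒱 d := fun i => by
    by_cases hi : i < l.length
    · rw [List.getD_eq_getElem _ _ hi]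
      exact hl _ (List.getElem_mem hi)
    · rw [List.getD_eq_default _ _ (not_lt.1 hi)]
      exact ⟨0, Submodule.zero_mem _⟩
  choose deg hdeg using h
  refine ⟨deg, fun i => l.getD i 0, hdeg, List.ext_getElem (by simp) fun i h1 h2 => ?_⟩
  rw [getElem_seqL, List.getD_eq_getElem _ _ h2]

/-- This is the 1-form part of the Maurer–Cartan equation contracted with the velocity. That
equation is given on homogeneous inputs only, so both sides are compared there and extended by
multilinearity. -/
theorem pathMaps_wDeriv [IsManifold I 1 M] (h𝒱 : DirectSum.IsInternal 𝒱) (hα : IsMaurerCartan α)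
    (h00 : ∀ x, α 0 0 x = 0) (h10 : ∀ x, α 1 0 x = 0)
    (hγ : ContMDiffOn 𝓘(ℝ, ℝ) I 1 γ (Set.Icc 0 1)) {ε : V →ₗ[ℝ] V} (hε : IsSign 𝒱 ε) (l : List V) :
    WDeriv (fun t => evL (pathMaps ψ α t) l) fun t =>
      ins .id (evL (pullbackOne α γ ψ t)) (evL (pathMaps ψ α t)) l -
        ins ε (evL (pathMaps ψ α t)) (evL (pullbackOne α γ ψ t)) l := by
  have hS := fun t => evL_isML (pathMaps ψ α t)
  have hA := fun t => evL_isML (pullbackOne α γ ψ t)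
  have hS' : ∀ t, IsML fun l => ins .id (evL (pullbackOne α γ ψ t)) (evL (pathMaps ψ α t)) l -
      ins ε (evL (pathMaps ψ α t)) (evL (pullbackOne α γ ψ t)) l :=
    fun t => ((hA t).ins (hS t)).sub ((hS t).ins (hA t))
  refine forall_list_of_homogeneous (DirectSum.IsInternal.submodule_iSup_eq_top h𝒱)
    (P := fun l => WDeriv (fun t => evL (pathMaps ψ α t) l) fun t =>
      ins .id (evL (pullbackOne α γ ψ t)) (evL (pathMaps ψ α t)) l -
        ins ε (evL (pathMaps ψ α t)) (evL (pullbackOne α γ ψ t)) l) ?_ ?_ ?_ l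
  · intro l₁ l₂
    exact (WDeriv.const (0 : V)).congr (fun t _ => (hS t).zero_mem (by simp))
      fun t _ => (hS' t).zero_mem (by simp)
  · intro l₁ l₂ x y hx hy
    exact (hx.add hy).congr (fun t _ => (hS t l₁ l₂).map_add x y)
      fun t _ => (hS' t l₁ l₂).map_add x y
  · intro l hl
    obtain ⟨deg, a, ha, hla⟩ := exists_seqL_eq hl
    rw [← hla]
    set n := l.length
    intro φ t ht
    obtain ⟨b, hb⟩ := L.exists_mem_baseSet (γ t)
    set u := mfderivWithin 𝓘(ℝ, ℝ) I γ (Set.Icc 0 1) t (1 : ℝ)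
    have h1 := pathForm_zero_hasDerivWithinAt ψ hα.smooth hγ ht hb n φ fun i => a i
    have h2 := hα.equation 1 n b (γ t) hb (φ ∘ₗ (ψ.transition b t).symm.toLinearMap) deg
      (fun i => ψ.transition b t (a i)) (fun i => by
        change L.triv b (γ t) ((ψ.toEquiv t).symm (a i)) ∈ _
        rw [L.triv_mem_iff b _ hb, ← ψ.mem_iff t ht, LinearEquiv.apply_symm_apply]
        exact ha i) fun _ => u
    have h3 : ∀ v, (L.triv b (γ t)).symm (ψ.transition b t v) = (ψ.toEquiv t).symm v := fun v => by
      rw [LinearEquiv.symm_apply_eq]; rfl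
    have h4 : ∀ z, (ψ.transition b t).symm (L.triv b (γ t) z) = ψ.toEquiv t z := fun z => by
      rw [LinearEquiv.symm_apply_eq]
      change _ = L.triv b (γ t) ((ψ.toEquiv t).symm (ψ.toEquiv t z))
      rw [LinearEquiv.symm_apply_apply]
    -- Vanishing nullary components turn the sums over all arities into insertions of nonempty
    -- blocks.
    have hS0 : pathMaps ψ α t 0 = 0 := by
      ext a; simp [pathMaps, structureMaps, h00]
    have hA0 : pullbackOne α γ ψ t 0 = 0 := by
      ext a; simp [pullbackOne, h10]
    have h5 : ψ.toEquiv t (selfBracket α 1 n (γ t) (fun _ => u) deg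
        fun i => (ψ.toEquiv t).symm (a i)) = (2 : ℝ) •
          (ins ε (evL (pathMaps ψ α t)) (evL (pullbackOne α γ ψ t)) (seqL n a) -
            ins .id (evL (pullbackOne α γ ψ t)) (evL (pathMaps ψ α t)) (seqL n a)) := by
      rw [selfBracket_one, ← sum_gComp_zero _ _ n deg, ← sum_gComp_one hε _ _ n ha,
        ← sum_antidiagonal_gComp _ _ hS0, ← sum_antidiagonal_gComp _ _ hA0, map_smul, map_sub,
        map_sum, map_sum]
      simp only [← gComp_conj]
      rfl
    simp only [h3, LinearMap.comp_apply, LinearEquiv.coe_coe, h4, h5, map_smul, map_sub,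
      smul_eq_mul] at h2
    simp only [evL_seqL]
    refine h1.congr_deriv ?_
    rw [map_sub]
    linarith

end MaurerCartan

end AInfFamily
end

/-! ### The A∞ morphism between two fibres -/

theorem mainTheorem2
    {E : Type*} [NormedAddCommGroup E] [NormedSpace ℝ E] [FiniteDimensional ℝ E]
    {H : Type*} [TopologicalSpace H] (I : ModelWithCorners ℝ E H)
    {M : Type*} [TopologicalSpace M] [ChartedSpace H M] [IsManifold I ∞ M]
    {V : Type*} [AddCommGroup V] [Module ℝ V] (𝒱 : ℤ → Submodule ℝ V)
    (h𝒱 : DirectSum.IsInternal 𝒱)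
    (L : AInfFamily.LocalSystem M 𝒱)
    (α : AInfFamily.HochschildForm I L) (hα : AInfFamily.IsMaurerCartan α)
    (h00 : ∀ x, α 0 0 x = 0) (h10 : ∀ x, α 1 0 x = 0) (h20 : ∀ x, α 2 0 x = 0)
    (h11 : ∀ x, α 1 1 x = 0)
    (γ : ℝ → M) (hγ : ContMDiffOn 𝓘(ℝ, ℝ) I 1 γ (Set.Icc 0 1))
    (ψ : AInfFamily.FlatTrivialization L γ)
    (d : ℕ) (p q : ℝ) (hp : p ∈ Set.Icc (0 : ℝ) 1) (hq : q ∈ Set.Icc (0 : ℝ) 1) :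
    ∃ F : ∀ n, MultilinearMap ℝ (fun _ : Fin n => L.fiber (γ p)) (L.fiber (γ q)),
      AInfFamily.IsTreeIntegral α γ ψ d p q F ∧
      AInfFamily.IsAInfMorphism (L.grading (γ p)) (L.grading (γ q))
        (AInfFamily.structureMaps α (γ p)) (AInfFamily.structureMaps α (γ q)) F := by
  open AInfFamily in
  have : IsManifold I 1 M := IsManifold.of_le (n := ∞) (by norm_cast)
  have hA := isConnection_pullbackOne ψ hα.smooth h11 hγ
  have hT := transport_isML hA hq p
  have hF : ∀ n, conj (ψ.toEquiv p) (ψ.toEquiv q)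
      (conj (ψ.toEquiv p).symm (ψ.toEquiv q).symm (hT.toMultilinearMap n)) =
      hT.toMultilinearMap n := fun n => by
    ext a; simp
  refine ⟨fun n => conj (ψ.toEquiv p).symm (ψ.toEquiv q).symm (hT.toMultilinearMap n),
    fun n hn a φ => ?_, isAInfAlgebra_structureMaps h𝒱 hα _, isAInfAlgebra_structureMaps h𝒱 hα _,
    fun n _ => ?_, fun n hn deg a ha => ?_⟩
  · rw [conj_apply, LinearEquiv.apply_symm_apply, LinearEquiv.symm_symm,
      hT.toMultilinearMap_seq n fun i => ψ.toEquiv p (a i)]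
    simp only [treeSum_eq]
    -- The truncation at `n + d` is harmless since at least `n` terms are kept and all later ones
    -- vanish.
    exact transport_eq_simplexIntegral hA hq hp (by simp) φ
  · refine isHomogeneous_conj (fun i v => ?_) (fun i v => ?_) ((transport_isHom hA hq
      (fun t ht => pullbackOne_isHom ψ hα ht) p).isHomogeneous hT n)
    · rw [← ψ.mem_iff p hp, LinearEquiv.apply_symm_apply]
    · rw [← ψ.mem_iff q hq, LinearEquiv.apply_symm_apply]
  · obtain ⟨ε, hε⟩ := exists_isSign h𝒱
    have hV := DirectSum.IsInternal.submodule_iSup_eq_top h𝒱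
    have ha' : ∀ i, ψ.toEquiv p (a i) ∈ 𝒱 (deg i) := fun i => (ψ.mem_iff p hp _ _).2 (ha i)
    have h1 := transport_cmp hA hq
      (fun t ht => (pullbackOne_isHom ψ hα ht).map_sign hV hε (evL_isML _))
      (fun t => evL_isML (pathMaps ψ α t)) (pathMaps_wDeriv ψ h𝒱 hα h00 h10 hγ hε) hp
      (l := seqL n fun i => ψ.toEquiv p (a i))
      (by rw [← List.length_pos_iff, length_seqL]; exact hn)
    have h2 := cmp_evL hT.toMultilinearMap (pathMaps ψ α q) n fun i => ψ.toEquiv p (a i)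
    have h3 := sum_gComp_one hε hT.toMultilinearMap (pathMaps ψ α p) n ha'
    rw [hT.evL_toMultilinearMap] at h2 h3
    rw [h2, ← h3] at h1
    -- The relation has been proved in `V`; it remains to carry it back to the fibres over `γ p` and
    -- `γ q`.
    apply (ψ.toEquiv q).injective
    rw [map_sum, map_sum]
    refine Eq.trans ?_ (h1.trans (Finset.sum_congr rfl fun m _ => ?_))
    · refine Finset.sum_congr rfl fun c _ => ?_
      simp only [pathMaps, conj_apply, LinearEquiv.symm_symm]
    · conv_lhs => rw [← hF]
      rw [pathMaps, gComp_conj]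
      simp only [LinearEquiv.symm_apply_apply]
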